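/- Let $p$ be a prime, $F$ a field of characteristic $p$, and $G$ a finite group with a normal Sylow $p$-subgroup $P$. Let $Q\le P$, set $H:=N_G(Q)$, and let $C\le H$ be a complement of the normal Sylow $p$-subgroup $N_P(Q)=P\cap H$ of $H$. A $p$-permutation $FG$-module is a finitely generated $FG$-module that has, for every $p$-subgroup $R\le G$, an $R$-stable $F$-basis. A vertex of an indecomposable $FG$-module $M$ is a subgroup $R\le G$ that is minimal with respect to inclusion such that $M$ is isomorphic to a direct summand of $\mathrm{Ind}_R^G(N)$ for some $FR$-module $N$. Let $S$ be a simple $FC$-module and view it as a simple $F(QC)$-module via the canonical isomorphism $C\cong QC/Q$. Then $M_S:=\mathrm{Ind}_{QC}^G(S)$ is an indecomposable $p$-permutation $FG$-module with vertex $Q$. Moreover, the map $S\mapsto M_S$ induces a bijection between the set of isomorphism classes of simple $FC$-modules and the set of isomorphism classes of indecomposable $p$-permutation $FG$-modules with vertex $Q$. -/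

import Mathlib

open CategoryTheory

universe u v w

namespace PPerm

/-- The canonical homomorphism `C → QC/Q`, `c ↦ cQ`, for `C` normalizing `Q`; here `Q ⊔ C = QC`. -/
def toQuot {G : Type v} [Group G] (Q C : Subgroup G) [(Q.subgroupOf (Q ⊔ C)).Normal] :
    C →* ↥(Q ⊔ C) ⧸ Q.subgroupOf (Q ⊔ C) :=
  (QuotientGroup.mk' _).comp (Subgroup.inclusion le_sup_right)

theorem normal_subgroupOf_sup {G : Type v} [Group G] {Q C : Subgroup G}
    (hC : C ≤ Subgroup.normalizer (Q : Set G)) : (Q.subgroupOf (Q ⊔ C)).Normal :=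
  Subgroup.normal_subgroupOf_of_le_normalizer (sup_le Subgroup.le_normalizer hC)

theorem toQuot_bijective {G : Type v} [Group G] {Q C : Subgroup G}
    [(Q.subgroupOf (Q ⊔ C)).Normal]
    (hC : C ≤ Subgroup.normalizer (Q : Set G)) (hQC : Disjoint Q C) :
    Function.Bijective (toQuot Q C) := by
  constructor
  · rw [injective_iff_map_eq_one]
    intro c hc
    have h1 : (c : G) ∈ Q := by
      simpa [toQuot, Subgroup.mem_subgroupOf] using hc
    exact Subtype.ext (Subgroup.disjoint_def.mp hQC h1 c.2)
  · intro y
    obtain ⟨⟨x, hx⟩, rfl⟩ := QuotientGroup.mk'_surjective _ y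
    have hx' : x ∈ C ⊔ Q := by rwa [sup_comm]
    rw [← SetLike.mem_coe, Subgroup.coe_mul_of_left_le_normalizer_right C Q hC] at hx'
    obtain ⟨c, hc, q, hq, rfl⟩ := hx'
    refine ⟨⟨c, hc⟩, ?_⟩
    simp only [toQuot, MonoidHom.comp_apply]
    refine QuotientGroup.eq.mpr ?_
    simpa [Subgroup.mem_subgroupOf] using hq

/-- The canonical isomorphism `C ≅ QC/Q`. -/
noncomputable def quotEquiv {G : Type v} [Group G] (Q C : Subgroup G)
    [(Q.subgroupOf (Q ⊔ C)).Normal]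
    (hC : C ≤ Subgroup.normalizer (Q : Set G)) (hQC : Disjoint Q C) :
    C ≃* ↥(Q ⊔ C) ⧸ Q.subgroupOf (Q ⊔ C) :=
  MulEquiv.ofBijective (toQuot Q C) (toQuot_bijective hC hQC)

/-- The projection `QC → QC/Q ≅ C`. -/
noncomputable def proj {G : Type v} [Group G] (Q C : Subgroup G)
    (hC : C ≤ Subgroup.normalizer (Q : Set G)) (hQC : Disjoint Q C) : ↥(Q ⊔ C) →* C :=
  haveI := normal_subgroupOf_sup hC
  (quotEquiv Q C hC hQC).symm.toMonoidHom.comp (QuotientGroup.mk' (Q.subgroupOf (Q ⊔ C)))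

/-- The functor `S ↦ M_S = Ind_{QC}^G(S)`, where the `FC`-module `S` is viewed as an
`F(QC)`-module through `QC → QC/Q ≅ C`. -/
noncomputable def inflInd (F : Type u) {G : Type v} [Field F] [Group G] (Q C : Subgroup G)
    (hC : C ≤ Subgroup.normalizer (Q : Set G)) (hQC : Disjoint Q C) :
    Rep.{max u v w} F C ⥤ Rep.{max u v w} F G :=
  Rep.resFunctor (proj Q C hC hQC) ⋙ Rep.indFunctor.{max u v w} F (Q ⊔ C).subtype

/-- `M` is a `p`-permutation module: it is finite-dimensional (for finite `G` this is the same as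
being finitely generated over `FG`) and for every `p`-subgroup `R` it has an `R`-stable
`F`-basis. -/
def IsPPermutation (p : ℕ) {F : Type u} {G : Type v} [Field F] [Group G]
    (M : Rep.{w} F G) : Prop :=
  Module.Finite F M.V ∧ ∀ R : Subgroup G, IsPGroup p R →
    ∃ (n : ℕ) (b : Module.Basis (Fin n) F M.V), ∀ r ∈ R, ∀ i, ∃ j, M.ρ r (b i) = b j

/-- `M` is relatively `R`-projective: it is isomorphic to a direct summand of a module induced
from `R`. -/
def IsRelProjective {F : Type u} {G : Type v} [Field F] [Group G]
    (M : Rep.{max u v w} F G) (R : Subgroup G) : Prop :=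
  ∃ N : Rep.{max u v w} F R, Nonempty (Retract M (Rep.ind R.subtype N))

/-- `Q` is a vertex of `M`: it is minimal among the subgroups `R` of `G` such that `M` is
relatively `R`-projective. -/
def IsVertex {F : Type u} {G : Type v} [Field F] [Group G]
    (M : Rep.{max u v w} F G) (Q : Subgroup G) : Prop :=
  Minimal (IsRelProjective.{u, v, w} M) Q

/-- `M` is an indecomposable `p`-permutation module with vertex `Q`. -/
def IsIndecPPermWithVertex (p : ℕ) {F : Type u} {G : Type v} [Field F] [Group G]
    (Q : Subgroup G) (M : Rep.{max u v w} F G) : Prop :=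
  CategoryTheory.Indecomposable M ∧ IsPPermutation p M ∧ IsVertex.{u, v, w} M Q

/-- Isomorphism classes of `FG`-modules. -/
abbrev IsoClass (F : Type u) (G : Type v) [Field F] [Group G] :=
  Quotient (isIsomorphicSetoid (Rep.{w} F G))

/-- The set of isomorphism classes of the `FG`-modules with a given property. -/
def isoClasses {F : Type u} {G : Type v} [Field F] [Group G] (X : Rep.{w} F G → Prop) :
    Set (IsoClass.{u, v, w} F G) :=
  Quotient.mk _ '' {M | X M}

/-- The map `[S] ↦ [M_S]` on isomorphism classes. -/
noncomputable def inflIndClass (F : Type u) {G : Type v} [Field F] [Group G] (Q C : Subgroup G)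
    (hC : C ≤ Subgroup.normalizer (Q : Set G)) (hQC : Disjoint Q C) :
    IsoClass.{u, v, max u v w} F C → IsoClass.{u, v, max u v w} F G :=
  Quotient.map (inflInd.{u, v, w} F Q C hC hQC).obj
    fun _ _ ⟨e⟩ => ⟨(inflInd.{u, v, w} F Q C hC hQC).mapIso e⟩

/-- A complement of `N_P(Q) = P ∩ N_G(Q)` in `N_G(Q)` meets `Q ≤ P` trivially. -/
theorem disjoint_of_compl {G : Type v} [Group G] {P Q C : Subgroup G} (hQ : Q ≤ P)
    (hC : C ≤ Subgroup.normalizer (Q : Set G))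
    (hcompl : (P.subgroupOf (Subgroup.normalizer (Q : Set G))).IsComplement'
      (C.subgroupOf (Subgroup.normalizer (Q : Set G)))) : Disjoint Q C := by
  rw [Subgroup.disjoint_def]
  intro x hxQ hxC
  have := Subgroup.disjoint_def.mp hcompl.disjoint
    (x := ⟨x, hC hxC⟩) (Subgroup.mem_subgroupOf.mpr (hQ hxQ)) (Subgroup.mem_subgroupOf.mpr hxC)
  exact congrArg Subtype.val this

end PPerm

/-!
Write `L = QC` and `M_S = Ind_L^G(S)`. The proof works with sums over cosets: the relative trace
`relTrace K f = ∑_{g ∈ G/K} g f g⁻¹`, and the pair `ι : S → M_S`, `π : M_S → S` of the inclusion and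
projection of the summand `1 ⊗ S`, with `relTrace L (ι π) = 1` (`IsInduced`). No Brauer construction
and no Krull-Schmidt theorem is needed; everything rests on the fact that in characteristic `p` the
sum over a finite `Q`-set of a `Q`-invariant function only sees the `Q`-fixed points. Since
`P ∩ L = Q`, and every `Q`-fixed point of `G/L` is of the form `xL` with `x ∈ P`, it follows that
sums of `Q`-invariant functions over `G/L` and over `P/Q` agree (`cosetSum_eq_cosetSum_subgroup`).

* To an `FG`-map `f : M_S → M_{S'}` is attached its core `S → S'`, sending `s` to
  `π' (f (∑_{x ∈ P/Q} x ⊗ s))`. By the comparison of sums the core is functorial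
  (`IsInflInduced.core_comp`), so an isomorphism `M_S ≅ M_{S'}` gives `S ≅ S'`. If the core of an
  idempotent `e` vanishes, then `e` kills the `P`-invariants of `M_S`, and `e = 0` because a nonzero
  module over the `p`-group `P` has nonzero invariants. By Schur's lemma the core of `e` is `0` or
  `1`, so `M_S` is indecomposable.
* `M_S` is a direct summand of a module induced from `Q`, by Higman's criterion and since `|C|` is
  invertible in `F`. It is not relatively `R`-projective for `R < Q`, since `Q` has no fixed points
  on `G/R` (`IsInflInduced.isVertex`). Suitable coset representatives give a basis permuted by `P`,
  hence by every `p`-subgroup (`IsInflInduced.isPPermutation`).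
* Let `M` be an indecomposable `p`-permutation module with vertex `Q`. Its identity is a trace
  from `Q`, and splits into traces indexed by the orbits of `Q` on a basis it permutes. As the
  endomorphism ring is local, one of these is an automorphism; by minimality of `Q` the orbit is a
  fixed point, which leaves the trace of a map `m ↦ l(m) x` with `x` and `l` invariant under `Q`
  (`IsIndecPPermWithVertex.exists_invariant`). Taking the trace up to `L` only, one finds an
  `L`-endomorphism `β` of `M` with `Q`-invariant image whose trace is an automorphism. If the rank of
  `β` is minimal, then its image `S` is a simple `FC`-module by Maschke's theorem, and `M` is a
  direct summand of `M_S`, hence isomorphic to it (`IsIndecPPermWithVertex.exists_iso`).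
-/

namespace PPerm

/-! ### Sums over cosets -/

section CosetSum

variable {G : Type*} [Group G] {V W : Type*} [AddCommMonoid V] [AddCommMonoid W]

/-- The sum of `F` over a set of representatives of the left cosets of `K`. It is meaningful when
`F` is constant on these cosets, and then does not depend on the representatives. -/
noncomputable def cosetSum (K : Subgroup G) (F : G → V) : V :=
  ∑ᶠ y : G ⧸ K, F y.out

theorem apply_out {α : Type*} {K : Subgroup G} {F : G → α} (hF : ∀ g, ∀ k ∈ K, F (g * k) = F g)
    (g : G) : F (Quotient.out (g : G ⧸ K)) = F g := by
  obtain ⟨k, hk⟩ := QuotientGroup.mk_out_eq_mul K g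
  rw [hk, hF g k k.2]

theorem cosetSum_mul_left {K : Subgroup G} {F : G → V} (hF : ∀ g, ∀ k ∈ K, F (g * k) = F g)
    (h : G) : cosetSum K (fun g => F (h * g)) = cosetSum K F := by
  unfold cosetSum
  rw [← finsum_comp_equiv (f := fun y => F y.out) (MulAction.toPerm h : Equiv.Perm (G ⧸ K))]
  refine finsum_congr fun y => ?_
  have hy : (MulAction.toPerm h : Equiv.Perm (G ⧸ K)) y = ((h * y.out : G) : G ⧸ K) := by
    conv_lhs => rw [← QuotientGroup.out_eq' y]
    rfl
  rw [hy, apply_out hF]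

theorem cosetSum_comp_mulEquiv {K : Subgroup G} {F : G → V}
    (hF : ∀ g, ∀ k ∈ K, F (g * k) = F g) (φ : G ≃* G) (hφ : ∀ g, g ∈ K ↔ φ g ∈ K) :
    cosetSum K (fun g => F (φ g)) = cosetSum K F := by
  unfold cosetSum
  let e : G ⧸ K ≃ G ⧸ K := Quotient.congr φ.toEquiv (by
    intro a b
    change QuotientGroup.leftRel K a b ↔ QuotientGroup.leftRel K (φ a) (φ b)
    rw [QuotientGroup.leftRel_apply, QuotientGroup.leftRel_apply, hφ, map_mul, map_inv])
  rw [← finsum_comp_equiv (f := fun y => F y.out) e]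
  refine finsum_congr fun y => ?_
  have h : e y = ((φ y.out : G) : G ⧸ K) := by
    conv_lhs => rw [← QuotientGroup.out_eq' y]
    rfl
  rw [h, apply_out hF]

theorem cosetSum_eq_single {K : Subgroup G} {F : G → V} (hF : ∀ g, ∀ k ∈ K, F (g * k) = F g)
    (g : G) (h : ∀ x, g⁻¹ * x ∉ K → F x = 0) : cosetSum K F = F g := by
  unfold cosetSum
  rw [finsum_eq_single _ (g : G ⧸ K), apply_out hF]
  intro y hy
  refine h _ fun hmem => hy ?_
  rw [← QuotientGroup.out_eq' y]
  exact (QuotientGroup.eq.mpr hmem).symm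

theorem map_cosetSum [Finite G] {E : Type*} [FunLike E V W] [AddMonoidHomClass E V W] (f : E)
    (K : Subgroup G) (F : G → V) : f (cosetSum K F) = cosetSum K (fun g => f (F g)) :=
  AddMonoidHom.map_finsum (f : V →+ W) (Set.toFinite _)

theorem cosetSum_congr {K : Subgroup G} {F F' : G → V} (h : ∀ g, F g = F' g) :
    cosetSum K F = cosetSum K F' := congrArg _ (funext h)

theorem cosetSum_add [Finite G] (K : Subgroup G) (F F' : G → V) :
    cosetSum K (fun g => F g + F' g) = cosetSum K F + cosetSum K F' :=
  finsum_add_distrib (Set.toFinite _) (Set.toFinite _)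

theorem cosetSum_finset_sum [Finite G] (K : Subgroup G) {κ : Type*} (s : Finset κ)
    (F : κ → G → V) : cosetSum K (fun g => ∑ i ∈ s, F i g) = ∑ i ∈ s, cosetSum K (F i) :=
  finsum_sum_comm _ _ fun _ _ => Set.toFinite _

theorem cosetSum_const [Finite G] (K : Subgroup G) (a : V) :
    cosetSum K (fun _ => a) = K.index • a := by
  unfold cosetSum
  have := Fintype.ofFinite (G ⧸ K)
  rw [finsum_eq_sum_of_fintype, Finset.sum_const, Finset.card_univ, Subgroup.index,
    Nat.card_eq_fintype_card]

theorem cosetSum_of_le [Finite G] {K L : Subgroup G} (hKL : K ≤ L) {F : G → V}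
    (hF : ∀ g, ∀ k ∈ K, F (g * k) = F g) :
    cosetSum K F = cosetSum L (fun g => cosetSum (K.subgroupOf L) (fun l : L => F (g * l))) := by
  unfold cosetSum
  rw [← finsum_comp_equiv (Subgroup.quotientEquivProdOfLE hKL).symm, finsum_curry]
  · refine finsum_congr fun y => finsum_congr fun z => ?_
    have h : (Subgroup.quotientEquivProdOfLE hKL).symm (y, z) =
        ((y.out * z.out : G) : G ⧸ K) := by
      conv_lhs => rw [← QuotientGroup.out_eq' z]
      rfl
    rw [h, apply_out hF]
  · exact Set.toFinite _

end CosetSum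

/-! ### Sums of functions invariant under a `p`-group -/

section PGroup

variable {p : ℕ} [Fact p.Prime] {V : Type*} [AddCommGroup V]

/-- A function on a finite set that is invariant under a `p`-group and vanishes on the fixed
points has sum zero in characteristic `p`: each of its nonempty fibres over a nonzero value is a
set with a fixed-point-free action, hence of size divisible by `p`. -/
theorem finsum_eq_zero_of_fixedPoints (hV : ∀ a : V, p • a = 0)
    {A : Type*} [Group A] (hA : IsPGroup p A) {X : Type*} [Finite X] [MulAction A X] (φ : X → V)
    (hφ : ∀ (a : A) x, φ (a • x) = φ x) (h0 : ∀ x, (∀ a : A, a • x = x) → φ x = 0) :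
    ∑ᶠ x, φ x = 0 := by
  classical
  have := Fintype.ofFinite X
  rw [finsum_eq_sum_of_fintype, ← Finset.sum_fiberwise_of_maps_to
    (t := Finset.univ.image φ) (g := φ) (by simp)]
  refine Finset.sum_eq_zero fun b _ => ?_
  rw [Finset.sum_congr rfl (g := fun _ => b) (by simp), Finset.sum_const]
  by_cases hb : b = 0
  · rw [hb, smul_zero]
  let Y : SubMulAction A X := ⟨{x | φ x = b}, fun a x hx => (hφ a x).trans hx⟩
  have hcard := hA.card_modEq_card_fixedPoints Y
  have hempty : IsEmpty (MulAction.fixedPoints A Y) := by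
    refine ⟨fun y => hb ?_⟩
    rw [← y.1.2]
    exact h0 _ fun a => congrArg Subtype.val (y.2 a)
  rw [Nat.card_of_isEmpty (α := MulAction.fixedPoints A Y), Nat.modEq_zero_iff_dvd] at hcard
  have hY : Nat.card Y = (Finset.univ.filter fun x => φ x = b).card := by
    rw [← Fintype.card_subtype, ← Nat.card_eq_fintype_card]; rfl
  obtain ⟨k, hk⟩ := hcard
  rw [← hY, hk, mul_comm, mul_smul, hV, smul_zero]

theorem finite_addSubgroup_closure (hV : ∀ a : V, p • a = 0) {X : Set V} (hX : X.Finite) :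
    Finite (AddSubgroup.closure X) := by
  have hfg : AddGroup.FG (AddSubgroup.closure X) :=
    (AddGroup.fg_iff_addSubgroup_fg _).mpr ⟨hX.toFinset, by rw [hX.coe_toFinset]⟩
  refine AddCommGroup.finite_of_fg_isAddTorsion _ fun x => ?_
  exact isOfFinAddOrder_iff_nsmul_eq_zero.mpr ⟨p, (Fact.out : p.Prime).pos, Subtype.ext (hV x)⟩

/-- A nonzero element of a module of characteristic `p` with an action of a finite `p`-group has
a nonzero invariant element in the additive subgroup generated by its orbit. -/
theorem exists_fixed_ne_zero (hV : ∀ a : V, p • a = 0) {A : Type*} [Group A] [Finite A]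
    (hA : IsPGroup p A) [DistribMulAction A V] {m : V} (hm : m ≠ 0) :
    ∃ n ∈ AddSubgroup.closure (Set.range fun a : A => a • m), n ≠ 0 ∧ ∀ a : A, a • n = n := by
  classical
  set U := AddSubgroup.closure (Set.range fun a : A => a • m) with hU
  have hUst : ∀ (a : A), ∀ n ∈ U, a • n ∈ U := by
    intro a n hn
    induction hn using AddSubgroup.closure_induction with
    | mem x hx =>
      obtain ⟨c, rfl⟩ := hx
      exact AddSubgroup.subset_closure ⟨a * c, mul_smul a c m⟩
    | zero => rw [smul_zero]; exact U.zero_mem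
    | add x y _ _ hx hy => rw [smul_add]; exact U.add_mem hx hy
    | neg x _ hx => rw [smul_neg]; exact U.neg_mem hx
  have hfin : Finite U := finite_addSubgroup_closure hV (Set.finite_range _)
  let Y : SubMulAction A V := ⟨U, fun a x hx => hUst a x hx⟩
  have : Finite Y := hfin
  have hp : p ∣ Nat.card Y := by
    have h1 : addOrderOf (⟨m, AddSubgroup.subset_closure ⟨1, one_smul A m⟩⟩ : U) = p :=
      addOrderOf_eq_prime (Subtype.ext (hV m)) fun h => hm (congrArg Subtype.val h)
    have h2 := addOrderOf_dvd_natCard (⟨m, AddSubgroup.subset_closure ⟨1, one_smul A m⟩⟩ : U)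
    rwa [h1] at h2
  obtain ⟨b, hb, hb0⟩ := hA.exists_fixed_point_of_prime_dvd_card_of_fixed_point Y hp
    (a := ⟨0, U.zero_mem⟩) (fun a => Subtype.ext (smul_zero a))
  exact ⟨b, b.2, fun h => hb0 (Subtype.ext h.symm), fun a => congrArg Subtype.val (hb a)⟩

variable {G : Type*} [Group G] [Finite G] {P Q L : Subgroup G}

/-- Comparison of sums over `G / L` and over `P / Q`: if `P ∩ L = Q` and if all cosets `gL` fixed
by the `p`-group `Q` come from `P`, then the two sums of a left `Q`-invariant function agree in
characteristic `p`. -/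
theorem cosetSum_eq_cosetSum_subgroup (hV : ∀ a : V, p • a = 0) (hQ : IsPGroup p Q) (hQP : Q ≤ P)
    (hQL : Q ≤ L) (hPL : ∀ x ∈ P, x ∈ L → x ∈ Q)
    (hfix : ∀ g, (∀ q ∈ Q, g⁻¹ * q * g ∈ L) → ∃ x ∈ P, x⁻¹ * g ∈ L) {F : G → V}
    (hF : ∀ g, ∀ k ∈ L, F (g * k) = F g) (hF' : ∀ q ∈ Q, ∀ g, F (q * g) = F g) :
    cosetSum L F = cosetSum (Q.subgroupOf P) (fun x : P => F x) := by
  classical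
  -- The inclusion `P / Q → G / L`.
  let j : P ⧸ Q.subgroupOf P → G ⧸ L := Quotient.map' Subtype.val (by
    intro a b hab
    rw [QuotientGroup.leftRel_apply] at hab ⊢
    exact hQL hab)
  have hj : ∀ x : P, j (x : P ⧸ Q.subgroupOf P) = ((x : G) : G ⧸ L) := fun _ => rfl
  have hinj : Function.Injective j := by
    intro a b hab
    induction a using QuotientGroup.induction_on with | H a =>
    induction b using QuotientGroup.induction_on with | H b =>
    rw [hj, hj, QuotientGroup.eq] at hab
    exact QuotientGroup.eq.mpr (hPL _ (a⁻¹ * b).2 hab)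
  set f : G ⧸ L → V := fun y => F y.out with hf
  have hfmk : ∀ g : G, f (g : G ⧸ L) = F g := fun g => apply_out hF g
  have h1 : cosetSum (Q.subgroupOf P) (fun x : P => F x) = ∑ᶠ y : P ⧸ Q.subgroupOf P, f (j y) := by
    refine finsum_congr fun y => ?_
    conv_rhs => rw [← QuotientGroup.out_eq' y]
    exact (hfmk _).symm
  have h2 : ∑ᶠ y : P ⧸ Q.subgroupOf P, f (j y) =
      ∑ᶠ y : G ⧸ L, if y ∈ Set.range j then f y else 0 := by
    rw [← finsum_mem_range hinj]
    refine finsum_congr fun y => ?_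
    rw [finsum_eq_if]
  have h3 : ∑ᶠ y : G ⧸ L, (if y ∈ Set.range j then 0 else f y) = 0 := by
    have hrange : ∀ (q : Q) (y : G ⧸ L), y ∈ Set.range j → q • y ∈ Set.range j := by
      rintro q _ ⟨x, rfl⟩
      induction x using QuotientGroup.induction_on with | H x =>
      exact ⟨((⟨q, hQP q.2⟩ * x : P) : P ⧸ Q.subgroupOf P), rfl⟩
    refine finsum_eq_zero_of_fixedPoints hV hQ _ (fun q y => ?_) fun y hy => if_pos ?_
    · have hiff : q • y ∈ Set.range j ↔ y ∈ Set.range j :=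
        ⟨fun h => by simpa using hrange q⁻¹ _ h, hrange q y⟩
      simp only [hiff]
      induction y using QuotientGroup.induction_on with | H g =>
      have : f (q • (g : G ⧸ L)) = f (g : G ⧸ L) := by
        change f (((q : G) * g : G) : G ⧸ L) = _
        rw [hfmk, hfmk, hF' q q.2]
      rw [this]
    · induction y using QuotientGroup.induction_on with | H g =>
      obtain ⟨x, hx, hxg⟩ := hfix g fun q hq => by
        have := hy (⟨q, hq⟩⁻¹ : Q)
        change ((q⁻¹ * g : G) : G ⧸ L) = (g : G ⧸ L) at this
        rw [QuotientGroup.eq] at this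
        simpa [mul_assoc] using this
      exact ⟨((⟨x, hx⟩ : P) : P ⧸ Q.subgroupOf P), QuotientGroup.eq.mpr hxg⟩
  rw [h1, h2]
  refine Eq.trans ?_ ((congrArg _ h3).trans (add_zero _))
  rw [← finsum_add_distrib (Set.toFinite _) (Set.toFinite _)]
  refine finsum_congr fun y => ?_
  change f y = _
  split_ifs
  · rw [add_zero]
  · rw [zero_add]

/-- If `R` is a proper subgroup of the `p`-group `Q`, then `Q` has no fixed point on `G / R`, so
that sums over `G / R` of left `Q`-invariant functions vanish in characteristic `p`. -/
theorem cosetSum_eq_zero_of_lt (hV : ∀ a : V, p • a = 0) (hQ : IsPGroup p Q) {R : Subgroup G}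
    (hR : R < Q) {F : G → V} (hF : ∀ g, ∀ k ∈ R, F (g * k) = F g)
    (hF' : ∀ q ∈ Q, ∀ g, F (q * g) = F g) : cosetSum R F = 0 := by
  have hfmk : ∀ g : G, F (Quotient.out (g : G ⧸ R)) = F g := fun g => apply_out hF g
  refine finsum_eq_zero_of_fixedPoints hV hQ _ (fun q y => ?_) fun y hy => ?_
  · induction y using QuotientGroup.induction_on with | H g =>
    change F (Quotient.out (((q : G) * g : G) : G ⧸ R)) = _
    rw [hfmk, hfmk, hF' q q.2]
  · exfalso
    induction y using QuotientGroup.induction_on with | H g =>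
    have hconj : ∀ q ∈ Q, g⁻¹ * q * g ∈ R := fun q hq => by
      have := hy (⟨q, hq⟩⁻¹ : Q)
      change ((q⁻¹ * g : G) : G ⧸ R) = (g : G ⧸ R) at this
      rw [QuotientGroup.eq] at this
      simpa [mul_assoc] using this
    have hle : Nat.card Q ≤ Nat.card R :=
      Nat.card_le_card_of_injective (fun q : Q => (⟨g⁻¹ * q * g, hconj q q.2⟩ : R)) (by
        intro a b hab
        have h := congrArg Subtype.val hab
        exact Subtype.ext (mul_left_cancel (mul_right_cancel h)))
    exact hR.ne (Subgroup.eq_of_le_of_card_ge hR.le hle)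

end PGroup

/-! ### Normal Sylow subgroups and complements in normalizers -/

section Groups

variable {p : ℕ} [Fact p.Prime] {G : Type*} [Group G] [Finite G] {P : Sylow p G} {Q C : Subgroup G}

theorem le_sylow_of_normal (hP : (P : Subgroup G).Normal) {R : Subgroup G} (hR : IsPGroup p R) :
    R ≤ P := by
  obtain ⟨P', hP'⟩ := hR.exists_le_sylow
  have := Sylow.unique_of_normal P hP
  rwa [Subsingleton.elim P P']

variable (hQ : Q ≤ P) (hC : C ≤ Subgroup.normalizer (Q : Set G))
  (hcompl : ((P : Subgroup G).subgroupOf (Subgroup.normalizer (Q : Set G))).IsComplement'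
      (C.subgroupOf (Subgroup.normalizer (Q : Set G))))
include hC hcompl

omit [Fact p.Prime] [Finite G] in
theorem disjoint_sylow_compl : Disjoint (P : Subgroup G) C := by
  rw [Subgroup.disjoint_def]
  intro x hxP hxC
  have := Subgroup.disjoint_def.mp hcompl.disjoint
    (x := ⟨x, hC hxC⟩) (Subgroup.mem_subgroupOf.mpr hxP) (Subgroup.mem_subgroupOf.mpr hxC)
  exact congrArg Subtype.val this

theorem not_dvd_card_compl (hP : (P : Subgroup G).Normal) : ¬ p ∣ Nat.card C := by
  intro h
  obtain ⟨c, hc⟩ := exists_prime_orderOf_dvd_card' p h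
  have hcp : IsPGroup p (Subgroup.zpowers (c : G)) := by
    refine IsPGroup.of_card (n := 1) ?_
    rw [Nat.card_zpowers, Subgroup.orderOf_coe, hc, pow_one]
  have h1 : (c : G) ∈ P := le_sylow_of_normal hP hcp (Subgroup.mem_zpowers _)
  have h2 := Subgroup.disjoint_def.mp (disjoint_sylow_compl hC hcompl) h1 c.2
  have h3 : c = 1 := Subtype.ext h2
  rw [h3, orderOf_one] at hc
  exact (Fact.out : p.Prime).one_lt.ne hc

omit [Fact p.Prime] [Finite G] hcompl in
theorem mem_sup_iff_exists {x : G} : x ∈ Q ⊔ C ↔ ∃ q ∈ Q, ∃ c ∈ C, q * c = x := by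
  rw [← SetLike.mem_coe, Subgroup.coe_mul_of_right_le_normalizer_left Q C hC, Set.mem_mul]
  rfl

include hQ in
omit [Fact p.Prime] [Finite G] in
theorem mem_of_mem_sylow_of_mem_sup {x : G} (hxP : x ∈ P) (hx : x ∈ Q ⊔ C) : x ∈ Q := by
  obtain ⟨q, hq, c, hc, rfl⟩ := (mem_sup_iff_exists hC).mp hx
  have hcP : c ∈ (P : Subgroup G) := by
    simpa using mul_mem (inv_mem (hQ hq)) hxP
  have h1 := Subgroup.disjoint_def.mp (disjoint_sylow_compl hC hcompl) hcP hc
  simpa [h1] using hq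

include hQ in
omit [Fact p.Prime] in
theorem exists_mem_sylow_of_conj (hP : (P : Subgroup G).Normal) {g : G}
    (hg : ∀ q ∈ Q, g⁻¹ * q * g ∈ Q ⊔ C) : ∃ x ∈ (P : Subgroup G), x⁻¹ * g ∈ Q ⊔ C := by
  have h1 : ∀ q ∈ Q, g⁻¹ * q * g ∈ Q := fun q hq =>
    mem_of_mem_sylow_of_mem_sup hQ hC hcompl
      (by have h := hP.conj_mem q (hQ hq) g⁻¹; rwa [inv_inv] at h) (hg q hq)
  have h2 : g⁻¹ ∈ Subgroup.normalizer (Q : Set G) := by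
    refine Subgroup.mem_normalizer_fintype fun q hq => ?_
    rw [inv_inv]
    exact h1 q hq
  have h3 : g ∈ Subgroup.normalizer (Q : Set G) := by simpa using inv_mem h2
  obtain ⟨⟨x, c⟩, hxc⟩ := hcompl.2 ⟨g, h3⟩
  refine ⟨x, x.2, ?_⟩
  have : (x : G) * (c : G) = g := congrArg Subtype.val hxc
  rw [← this, inv_mul_cancel_left]
  exact (le_sup_right : C ≤ Q ⊔ C) c.2

end Groups

/-! ### The relative trace -/

section RelTrace

variable {k : Type*} [CommRing k] {G : Type*} [Group G] {U V W : Type*}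
  [AddCommGroup U] [Module k U] [AddCommGroup V] [Module k V] [AddCommGroup W] [Module k W]
  {τ : Representation k G U} {ρ : Representation k G V} {σ : Representation k G W}
  {K : Subgroup G}

/-- The relative trace `Tr_K^G(f) = ∑_{g ∈ G/K} g f g⁻¹` of a `K`-equivariant map `f`. -/
noncomputable def relTrace (K : Subgroup G) (ρ : Representation k G V) (σ : Representation k G W)
    (f : V →ₗ[k] W) : V →ₗ[k] W :=
  cosetSum K fun g => σ g ∘ₗ f ∘ₗ ρ g⁻¹

theorem relTrace_apply [Finite G] (f : V →ₗ[k] W) (v : V) :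
    relTrace K ρ σ f v = cosetSum K fun g => σ g (f (ρ g⁻¹ v)) :=
  map_cosetSum (LinearMap.applyₗ v) K _

/-- For `K`-equivariant `f` the summand `g f g⁻¹` of the relative trace depends only on `gK`. -/
theorem conj_mul_of_mem {f : V →ₗ[k] W} (hf : ∀ g ∈ K, ∀ v, f (ρ g v) = σ g (f v)) (g : G) {l : G}
    (hl : l ∈ K) : σ (g * l) ∘ₗ f ∘ₗ ρ (g * l)⁻¹ = σ g ∘ₗ f ∘ₗ ρ g⁻¹ := by
  ext v
  simp only [LinearMap.comp_apply, map_mul, mul_inv_rev, Module.End.mul_apply,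
    hf l⁻¹ (inv_mem hl), Representation.self_inv_apply]

theorem relTrace_equivariant [Finite G] {f : V →ₗ[k] W}
    (hf : ∀ g ∈ K, ∀ v, f (ρ g v) = σ g (f v)) (h : G) (v : V) :
    relTrace K ρ σ f (ρ h v) = σ h (relTrace K ρ σ f v) := by
  rw [relTrace_apply, relTrace_apply, map_cosetSum (σ h)]
  rw [← cosetSum_mul_left (h := h)]
  · refine cosetSum_congr fun g => ?_
    simp only [map_mul, mul_inv_rev, Module.End.mul_apply, Representation.inv_self_apply]
  · intro g l hl
    exact LinearMap.congr_fun (conj_mul_of_mem hf g hl) (ρ h v)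

theorem relTrace_comp [Finite G] (f : V →ₗ[k] W) {h : U →ₗ[k] V}
    (hh : ∀ g u, h (τ g u) = ρ g (h u)) :
    relTrace K ρ σ f ∘ₗ h = relTrace K τ σ (f ∘ₗ h) := by
  ext u
  simp only [LinearMap.comp_apply, relTrace_apply, hh]

theorem comp_relTrace [Finite G] (f : U →ₗ[k] V) {h : V →ₗ[k] W}
    (hh : ∀ g v, h (ρ g v) = σ g (h v)) :
    h ∘ₗ relTrace K τ ρ f = relTrace K τ σ (h ∘ₗ f) := by
  ext u
  simp only [LinearMap.comp_apply, relTrace_apply, map_cosetSum h, hh]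

theorem relTrace_add [Finite G] (f f' : V →ₗ[k] W) :
    relTrace K ρ σ (f + f') = relTrace K ρ σ f + relTrace K ρ σ f' := by
  ext v
  simp only [LinearMap.add_apply, relTrace_apply, map_add, cosetSum_add]

theorem relTrace_finset_sum [Finite G] {κ : Type*} (s : Finset κ) (f : κ → V →ₗ[k] W) :
    relTrace K ρ σ (∑ i ∈ s, f i) = ∑ i ∈ s, relTrace K ρ σ (f i) := by
  ext v
  simp only [LinearMap.sum_apply, relTrace_apply, map_sum, cosetSum_finset_sum]

/-- Transitivity of the relative trace: `Tr_K^G = Tr_L^G ∘ Tr_K^L`. -/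
theorem relTrace_of_le [Finite G] {L : Subgroup G} (hKL : K ≤ L) {f : V →ₗ[k] W}
    (hf : ∀ g ∈ K, ∀ v, f (ρ g v) = σ g (f v)) :
    relTrace K ρ σ f = relTrace L ρ σ
      (relTrace (K.subgroupOf L) (ρ.comp L.subtype) (σ.comp L.subtype) f) := by
  unfold relTrace
  rw [cosetSum_of_le hKL fun g l hl => conj_mul_of_mem hf g hl]
  refine cosetSum_congr fun g => ?_
  ext v
  rw [LinearMap.comp_apply, LinearMap.comp_apply]
  have h1 := fun F : L → V →ₗ[k] W =>
    map_cosetSum (LinearMap.applyₗ (R := k) (M₂ := W) (ρ g⁻¹ v)) (K.subgroupOf L) F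
  have h2 := fun F : L → V →ₗ[k] W =>
    map_cosetSum (LinearMap.applyₗ (R := k) (M₂ := W) v) (K.subgroupOf L) F
  simp only [LinearMap.applyₗ_apply_apply] at h1 h2
  rw [h1, h2, map_cosetSum (σ g)]
  refine cosetSum_congr fun l => ?_
  simp [mul_inv_rev]

end RelTrace

/-! ### Induced representations -/

section Induced

variable {k : Type*} [CommRing k] {G : Type*} [Group G] {L : Subgroup G} {M N V : Type*}
  [AddCommGroup M] [Module k M] [AddCommGroup N] [Module k N] [AddCommGroup V] [Module k V]

/-- A representation `ρ` of `G` on `M` is induced from the representation `σ` of the subgroup `L`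
on `N`, by means of the inclusion `ι : N → M`, `n ↦ 1 ⊗ n` and the projection `π : M → N` onto the
summand `1 ⊗ N` of `M = ⨁_{g ∈ G/L} g ⊗ N`. -/
structure IsInduced (ρ : Representation k G M) (σ : Representation k L N) (ι : N →ₗ[k] M)
    (π : M →ₗ[k] N) : Prop where
  map_ι (l : L) (n : N) : ι (σ l n) = ρ l (ι n)
  map_π (l : L) (m : M) : π (ρ l m) = σ l (π m)
  π_ι (n : N) : π (ι n) = n
  π_ρ_ι (g : G) (hg : g ∉ L) (n : N) : π (ρ g (ι n)) = 0
  sum (m : M) : cosetSum L (fun g => ρ g (ι (π (ρ g⁻¹ m)))) = m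

open Representation in
/-- The model of the induced module as coinvariants of `k[G] ⊗ N`, in which `g` sends the class of
`h ⊗ n` to that of `h g⁻¹ ⊗ n`, so that the summand `g ⊗ N` consists of the classes of the
`g⁻¹ ⊗ n`. -/
theorem exists_isInduced_ind [Finite G] (σ : Representation k L N) :
    ∃ ι π, IsInduced (σ.ind L.subtype) σ ι π := by
  classical
  let π : IndV L.subtype σ →ₗ[k] N := Coinvariants.lift _
    (TensorProduct.lift <| (Finsupp.lift _ _ _ fun h : G =>
      if hh : h ∈ L then σ ⟨h, hh⟩⁻¹ else 0) ∘ₗ (MonoidAlgebra.coeffLinearEquiv k).toLinearMap)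
    fun l => by
      ext h n
      by_cases hh : h ∈ L
      · have h2 : (l : G) * h ∈ L := mul_mem l.2 hh
        have h3 : (⟨(l : G) * h, h2⟩ : L) = l * ⟨h, hh⟩ := rfl
        simp [ofMulAction_single, hh, h2, h3]
      · have h2 : (l : G) * h ∉ L := fun h2 => hh ((mul_mem_cancel_left l.2).mp h2)
        simp [ofMulAction_single, hh, h2]
  have hπ : ∀ (h : G) (n : N), π (IndV.mk L.subtype σ h n) =
      if hh : h ∈ L then σ ⟨h, hh⟩⁻¹ n else 0 := by
    intro h n
    by_cases hh : h ∈ L <;> simp [π, hh]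
  have hρ : ∀ (g h : G) (n : N), σ.ind L.subtype g (IndV.mk L.subtype σ h n) =
      IndV.mk L.subtype σ (h * g⁻¹) n := fun g h n => ind_mk L.subtype σ g h n
  have hι : ∀ (g : G) (n : N), σ.ind L.subtype g (IndV.mk L.subtype σ 1 n) =
      IndV.mk L.subtype σ g⁻¹ n := by
    intro g n
    rw [hρ, one_mul]
  have hmk : ∀ (l : L) (n : N), IndV.mk L.subtype σ 1 (σ l n) =
      IndV.mk L.subtype σ (l : G)⁻¹ n := by
    intro l n
    have := Coinvariants.mk_self_apply (ρ := Representation.tprod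
      ((leftRegular k G).comp L.subtype) σ) l (TensorProduct.tmul k (.single (l : G)⁻¹ 1) n)
    simpa [ofMulAction_single] using this
  have hιπ : ∀ (l : L) (n : N), IndV.mk L.subtype σ 1 (σ l n) =
      σ.ind L.subtype l (IndV.mk L.subtype σ 1 n) := fun l n => by rw [hmk, hι]
  have hππ : ∀ (l : L) (m), π (σ.ind L.subtype l m) = σ l (π m) := by
    intro l m
    refine LinearMap.congr_fun (f := π ∘ₗ σ.ind L.subtype l) (g := σ l ∘ₗ π) ?_ m
    refine IndV.hom_ext _ _ fun h => LinearMap.ext fun n => ?_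
    change π (σ.ind L.subtype l (IndV.mk L.subtype σ h n)) = σ l (π (IndV.mk L.subtype σ h n))
    rw [hρ, hπ, hπ]
    by_cases hh : h ∈ L
    · have h2 : h * (l : G)⁻¹ ∈ L := mul_mem hh (inv_mem l.2)
      have h3 : (⟨h * (l : G)⁻¹, h2⟩ : L)⁻¹ = l * ⟨h, hh⟩⁻¹ := Subtype.ext (by simp)
      rw [dif_pos hh, dif_pos h2, h3, map_mul, Module.End.mul_apply]
    · rw [dif_neg hh, dif_neg fun h2 => hh ((mul_mem_cancel_right (inv_mem l.2)).mp h2), map_zero]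
  have hπι : ∀ n, π (IndV.mk L.subtype σ 1 n) = n := fun n => by
    rw [hπ, dif_pos (one_mem L)]
    change σ (1 : L)⁻¹ n = n
    rw [inv_one, map_one, Module.End.one_apply]
  have hπρι : ∀ g ∉ L, ∀ n, π (σ.ind L.subtype g (IndV.mk L.subtype σ 1 n)) = 0 :=
    fun g hg n => by rw [hι, hπ, dif_neg (by simpa using hg)]
  have hequiv : ∀ g ∈ L, ∀ m, (IndV.mk L.subtype σ 1 ∘ₗ π) (σ.ind L.subtype g m) =
      σ.ind L.subtype g ((IndV.mk L.subtype σ 1 ∘ₗ π) m) := fun g hg m => by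
    have h1 := hιπ ⟨g, hg⟩ (π m)
    rw [← hππ ⟨g, hg⟩ m] at h1
    exact h1
  refine ⟨IndV.mk L.subtype σ 1, π, hιπ, hππ, hπι, hπρι, fun m => ?_⟩
  have htr : relTrace L (σ.ind L.subtype) (σ.ind L.subtype) (IndV.mk L.subtype σ 1 ∘ₗ π) =
      LinearMap.id := by
    refine IndV.hom_ext _ _ fun h => LinearMap.ext fun n => ?_
    change relTrace L (σ.ind L.subtype) (σ.ind L.subtype) (IndV.mk L.subtype σ 1 ∘ₗ π)
      (IndV.mk L.subtype σ h n) = IndV.mk L.subtype σ h n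
    rw [← inv_inv h, ← hι, relTrace_equivariant hequiv, relTrace_apply, cosetSum_eq_single _ 1]
    · rw [inv_one, map_one, Module.End.one_apply, Module.End.one_apply, LinearMap.comp_apply, hπι]
    · intro g hg
      rw [LinearMap.comp_apply, hπρι, map_zero, map_zero]
      simpa using hg
    · intro g l hl
      exact LinearMap.congr_fun (conj_mul_of_mem hequiv g hl) _
  refine Eq.trans ?_ (LinearMap.congr_fun htr m)
  rw [relTrace_apply]
  rfl

namespace IsInduced

variable {ρ : Representation k G M} {σ : Representation k L N} {ι : N →ₗ[k] M} {π : M →ₗ[k] N}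
  {τ : Representation k G V}

theorem comp_equivariant (h : IsInduced ρ σ ι π) : ∀ g ∈ L, ∀ m,
    (ι ∘ₗ π) (ρ g m) = ρ g ((ι ∘ₗ π) m) := fun g hg m => by
  rw [LinearMap.comp_apply, LinearMap.comp_apply, h.map_π ⟨g, hg⟩, h.map_ι ⟨g, hg⟩]

theorem relTrace_eq_id [Finite G] (h : IsInduced ρ σ ι π) :
    relTrace L ρ ρ (ι ∘ₗ π) = LinearMap.id := by
  ext m
  rw [relTrace_apply]
  exact h.sum m

/-- The map `m ↦ ∑ g ⊗ a(g⁻¹ m)` into an induced module is the one with component `a`. -/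
theorem comp_relTrace_ι [Finite G] (h : IsInduced ρ σ ι π) {a : V →ₗ[k] N}
    (ha : ∀ (l : L) v, a (τ l v) = σ l (a v)) : π ∘ₗ relTrace L τ ρ (ι ∘ₗ a) = a := by
  have hιa : ∀ g ∈ L, ∀ v, (ι ∘ₗ a) (τ g v) = ρ g ((ι ∘ₗ a) v) := fun g hg v => by
    rw [LinearMap.comp_apply, LinearMap.comp_apply, ha ⟨g, hg⟩, h.map_ι ⟨g, hg⟩]
  ext v
  rw [LinearMap.comp_apply, relTrace_apply, map_cosetSum π, cosetSum_eq_single _ 1]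
  · rw [inv_one, map_one, map_one, Module.End.one_apply, Module.End.one_apply,
      LinearMap.comp_apply, h.π_ι]
  · intro g hg
    refine h.π_ρ_ι g ?_ _
    simpa using hg
  · intro g l hl
    exact congrArg π (LinearMap.congr_fun (conj_mul_of_mem hιa g hl) v)

end IsInduced

end Induced

/-! ### Higman's criterion -/

section Rep

variable {F : Type u} {G : Type v} [Field F] [Group G] [Finite G] {R : Subgroup G}

/-- If the trace of the composite of `R`-equivariant maps `a : M → N` and `b : N → M` is the
identity, then `M` is a direct summand of the module induced from `N`. -/
theorem nonempty_retract_ind {M : Rep.{max u v w} F G} {N : Rep.{max u v w} F R}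
    {a : M.V →ₗ[F] N.V} {b : N.V →ₗ[F] M.V} (ha : ∀ (r : R) m, a (M.ρ r m) = N.ρ r (a m))
    (hb : ∀ (r : R) n, b (N.ρ r n) = M.ρ r (b n))
    (h : relTrace R M.ρ M.ρ (b ∘ₗ a) = LinearMap.id) :
    Nonempty (Retract M (Rep.ind R.subtype N)) := by
  obtain ⟨ι, π, hind⟩ := exists_isInduced_ind N.ρ
  have hιa : ∀ g ∈ R, ∀ m, (ι ∘ₗ a) (M.ρ g m) = N.ρ.ind R.subtype g ((ι ∘ₗ a) m) :=
    fun g hg m => by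
      rw [LinearMap.comp_apply, LinearMap.comp_apply, ha ⟨g, hg⟩, hind.map_ι ⟨g, hg⟩]
  have hbπ : ∀ g ∈ R, ∀ m, (b ∘ₗ π) (N.ρ.ind R.subtype g m) = M.ρ g ((b ∘ₗ π) m) :=
    fun g hg m => by
      rw [LinearMap.comp_apply, LinearMap.comp_apply, hind.map_π ⟨g, hg⟩, hb ⟨g, hg⟩]
  let i : M ⟶ Rep.ind R.subtype N :=
    Rep.ofHom ⟨relTrace R M.ρ (N.ρ.ind R.subtype) (ι ∘ₗ a), fun g =>
      LinearMap.ext fun m => relTrace_equivariant hιa g m⟩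
  let r : Rep.ind R.subtype N ⟶ M :=
    Rep.ofHom ⟨relTrace R (N.ρ.ind R.subtype) M.ρ (b ∘ₗ π), fun g =>
      LinearMap.ext fun m => relTrace_equivariant hbπ g m⟩
  refine ⟨⟨i, r, ?_⟩⟩
  refine Rep.hom_ext (Representation.IntertwiningMap.ext ?_)
  change relTrace R (N.ρ.ind R.subtype) M.ρ (b ∘ₗ π) ∘ₗ
    relTrace R M.ρ (N.ρ.ind R.subtype) (ι ∘ₗ a) = LinearMap.id
  rw [relTrace_comp _ (relTrace_equivariant hιa), LinearMap.comp_assoc, hind.comp_relTrace_ι ha, h]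

/-- Higman's criterion: `M` is relatively `R`-projective if and only if its identity is the
relative trace of an `R`-endomorphism. -/
theorem isRelProjective_iff {M : Rep.{max u v w} F G} :
    IsRelProjective.{u, v, w} M R ↔ ∃ α : M.V →ₗ[F] M.V,
      (∀ r ∈ R, ∀ m, α (M.ρ r m) = M.ρ r (α m)) ∧ relTrace R M.ρ M.ρ α = LinearMap.id := by
  constructor
  · rintro ⟨N, ⟨i, r, hir⟩⟩
    obtain ⟨ι, π, hind⟩ := exists_isInduced_ind N.ρ
    have hi : ∀ g m, i.hom.toLinearMap (M.ρ g m) = N.ρ.ind R.subtype g (i.hom.toLinearMap m) :=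
      fun g m => Rep.hom_comm_apply i g m
    have hr : ∀ g m, r.hom.toLinearMap (N.ρ.ind R.subtype g m) = M.ρ g (r.hom.toLinearMap m) :=
      fun g m => Rep.hom_comm_apply r g m
    refine ⟨r.hom.toLinearMap ∘ₗ (ι ∘ₗ π) ∘ₗ i.hom.toLinearMap, fun g hg m => ?_, ?_⟩
    · rw [LinearMap.comp_apply, LinearMap.comp_apply, hi, hind.comp_equivariant g hg, hr]
      rfl
    · rw [← comp_relTrace _ hr, ← relTrace_comp _ hi, hind.relTrace_eq_id, LinearMap.id_comp,
        ← Rep.hom_comp_toLinearMap, hir]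
      rfl
  · rintro ⟨α, hα, htr⟩
    refine ⟨Rep.res R.subtype M, nonempty_retract_ind (a := α) (b := LinearMap.id)
      (fun r m => hα r r.2 m) (fun r m => rfl) ?_⟩
    rwa [LinearMap.id_comp]

end Rep

/-! ### Indecomposable modules and Fitting's lemma -/

section Indecomposable

/-- An object of a preadditive category in which idempotents split is indecomposable if and only
if it is nonzero and has no nontrivial idempotent endomorphisms. -/
theorem indecomposable_iff {A : Type*} [Category* A] [Preadditive A]
    [Limits.HasBinaryBiproducts A] [IsIdempotentComplete A] {X : A} :
    Indecomposable X ↔ ¬ Limits.IsZero X ∧ ∀ e : X ⟶ X, e ≫ e = e → e = 0 ∨ e = 𝟙 X := by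
  refine and_congr_right fun _ => ⟨fun h e he => ?_, fun h Y Z i => ?_⟩
  · obtain ⟨Y, i, r, hir, hri⟩ := IsIdempotentComplete.idempotents_split X e he
    have he' : (𝟙 X - e) ≫ (𝟙 X - e) = 𝟙 X - e := by simp [he]
    obtain ⟨Z, j, s, hjs, hsj⟩ := IsIdempotentComplete.idempotents_split X (𝟙 X - e) he'
    have hmono : Mono j := ⟨fun f g hfg => by simpa [hjs] using hfg =≫ s⟩
    have hmono' : Mono i := ⟨fun f g hfg => by simpa [hir] using hfg =≫ r⟩
    have h1 : j ≫ r = 0 := by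
      have h2 : j ≫ (𝟙 X - e) = j := by rw [← hsj, ← Category.assoc, hjs, Category.id_comp]
      have h3 : j ≫ e = 0 := by simpa using h2
      rw [← cancel_mono i, Category.assoc, hri, h3, Limits.zero_comp]
    have h1' : i ≫ s = 0 := by
      have h2 : i ≫ e = i := by rw [← hri, ← Category.assoc, hir, Category.id_comp]
      rw [← cancel_mono j, Category.assoc, hsj, Preadditive.comp_sub, h2, Category.comp_id,
        sub_self, Limits.zero_comp]
    let b : Limits.BinaryBicone Y Z := ⟨X, r, s, i, j, hir, h1', h1, hjs⟩
    have hb : b.IsBilimit := Limits.isBinaryBilimitOfTotal b (by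
      change r ≫ i + s ≫ j = 𝟙 X
      rw [hri, hsj, add_sub_cancel])
    rcases h Y Z (Limits.biprod.uniqueUpToIso Y Z hb) with hY | hZ
    · left
      rw [← hri, hY.eq_of_src i 0, Limits.comp_zero]
    · right
      rw [hZ.eq_of_src j 0, Limits.comp_zero] at hsj
      exact (sub_eq_zero.mp hsj.symm).symm
  · have hidem : (i.hom ≫ Limits.biprod.fst ≫ Limits.biprod.inl ≫ i.inv) ≫
        (i.hom ≫ Limits.biprod.fst ≫ Limits.biprod.inl ≫ i.inv) =
        i.hom ≫ Limits.biprod.fst ≫ Limits.biprod.inl ≫ i.inv := by simp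
    rcases h _ hidem with h0 | h1
    · left
      rw [Limits.IsZero.iff_id_eq_zero]
      have := congrArg (fun f => Limits.biprod.inl ≫ i.inv ≫ f ≫ i.hom ≫ Limits.biprod.fst) h0
      simpa using this
    · right
      rw [Limits.IsZero.iff_id_eq_zero]
      have := congrArg (fun f => Limits.biprod.inr ≫ i.inv ≫ f ≫ i.hom ≫ Limits.biprod.snd) h1
      simpa using this.symm

variable {F : Type u} {G : Type v} [Field F] [Group G]

theorem indecomposable_rep_iff {M : Rep.{w} F G} :
    Indecomposable M ↔ Nontrivial M.V ∧ ∀ e : M.V →ₗ[F] M.V,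
      (∀ g m, e (M.ρ g m) = M.ρ g (e m)) → e ∘ₗ e = e → e = 0 ∨ e = LinearMap.id := by
  rw [indecomposable_iff, Rep.isZero_iff, not_subsingleton_iff_nontrivial]
  refine and_congr_right fun _ => ⟨fun h e he hee => ?_, fun h e hee => ?_⟩
  · refine (h (Rep.ofHom ⟨e, fun g => LinearMap.ext (he g)⟩) ?_).imp (fun h0 => ?_) fun h1 => ?_
    · exact Rep.hom_ext (Representation.IntertwiningMap.ext hee)
    · exact congrArg (fun f : M ⟶ M => f.hom.toLinearMap) h0
    · exact congrArg (fun f : M ⟶ M => f.hom.toLinearMap) h1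
  · refine (h e.hom.toLinearMap (fun g m => Rep.hom_comm_apply e g m) ?_).imp (fun h0 => ?_)
      fun h1 => ?_
    · exact congrArg (fun f : M ⟶ M => f.hom.toLinearMap) hee
    · exact Rep.hom_ext (Representation.IntertwiningMap.ext h0)
    · exact Rep.hom_ext (Representation.IntertwiningMap.ext h1)

theorem projection_equivariant {M : Type*} [AddCommGroup M] [Module F M] {p q : Submodule F M}
    (hpq : IsCompl p q) {f : M →ₗ[F] M} (hp : ∀ x ∈ p, f x ∈ p) (hq : ∀ x ∈ q, f x ∈ q) (x : M) :
    p.projection q hpq (f x) = f (p.projection q hpq x) := by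
  obtain ⟨y, hy, z, hz, rfl⟩ := Submodule.mem_sup.mp (hpq.sup_eq_top.ge (Submodule.mem_top (x := x)))
  rw [map_add, map_add, map_add, (p.projection_apply_eq_zero_iff hpq).mpr hz,
    (p.projection_apply_eq_zero_iff hpq).mpr (hq z hz), Submodule.projection_apply_of_mem_left hpq hy,
    Submodule.projection_apply_of_mem_left hpq (hp y hy), add_zero, add_zero]

/-- Fitting's lemma: an endomorphism of a finite-dimensional indecomposable module is bijective or
nilpotent. -/
theorem bijective_or_isNilpotent {M : Rep.{w} F G} [Module.Finite F M.V] (hM : Indecomposable M)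
    {f : Module.End F M.V} (hf : ∀ g m, f (M.ρ g m) = M.ρ g (f m)) :
    Function.Bijective f ∨ IsNilpotent f := by
  obtain ⟨n, hn, hc⟩ := (LinearMap.eventually_isCompl_ker_pow_range_pow f).and
    (Filter.eventually_ge_atTop 1) |>.exists |>.imp fun n h => And.intro h.2 h.1
  have hfn : ∀ g m, (f ^ n) (M.ρ g m) = M.ρ g ((f ^ n) m) := by
    intro g m
    have hc : Commute f (M.ρ g) := LinearMap.ext (hf g)
    exact LinearMap.congr_fun (hc.pow_left n) m
  have he : ∀ g m, (LinearMap.ker (f ^ n)).projection _ hc (M.ρ g m) =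
      M.ρ g ((LinearMap.ker (f ^ n)).projection _ hc m) := by
    refine fun g => projection_equivariant hc (fun x hx => ?_) ?_
    · rw [LinearMap.mem_ker] at hx ⊢
      rw [hfn, hx, map_zero]
    · rintro _ ⟨x, rfl⟩
      exact ⟨M.ρ g x, hfn g x⟩
  rcases (indecomposable_rep_iff.mp hM).2 ((LinearMap.ker (f ^ n)).projection _ hc) he
      (Submodule.isIdempotentElem_projection hc) with h | h
  · left
    have hk : LinearMap.ker (f ^ n) = ⊥ := by
      rw [← Submodule.range_projection hc, h, LinearMap.range_zero]
    have hinj : Function.Injective f := by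
      have h1 : Function.Injective (f ^ n) := LinearMap.ker_eq_bot.mp hk
      rw [← Nat.sub_add_cancel hn, pow_succ] at h1
      exact Function.Injective.of_comp h1
    exact ⟨hinj, LinearMap.surjective_of_injective hinj⟩
  · right
    refine ⟨n, LinearMap.ker_eq_top.mp ?_⟩
    rw [← Submodule.range_projection hc, h, LinearMap.range_id]

/-- The endomorphism ring of a finite-dimensional indecomposable module is local. -/
theorem bijective_or_bijective_of_add {M : Rep.{w} F G} [Module.Finite F M.V]
    (hM : Indecomposable M) {f f' : Module.End F M.V} (hf : ∀ g m, f (M.ρ g m) = M.ρ g (f m))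
    (hf' : ∀ g m, f' (M.ρ g m) = M.ρ g (f' m)) (h : Function.Bijective (f + f' : Module.End F M.V)) :
    Function.Bijective f ∨ Function.Bijective f' := by
  -- After composing with the inverse of `f + f'` the two maps have sum the identity.
  let e := LinearEquiv.ofBijective (f + f') h
  have he : ∀ g m, e.symm (M.ρ g m) = M.ρ g (e.symm m) := fun g m => by
    rw [LinearEquiv.symm_apply_eq]
    change M.ρ g m = f (M.ρ g (e.symm m)) + f' (M.ρ g (e.symm m))
    rw [hf, hf', ← map_add]
    exact congrArg _ (e.apply_symm_apply m).symm
  have hcomp : ∀ x : Module.End F M.V, Function.Bijective (e.symm.toLinearMap * x) →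
      Function.Bijective x := fun x hx =>
    (Function.Bijective.of_comp_iff' e.symm.bijective x).mp hx
  rcases bijective_or_isNilpotent hM (f := e.symm.toLinearMap * f)
      (fun g m => by simp only [Module.End.mul_apply, hf]; exact he g _) with h1 | h1
  · exact Or.inl (hcomp _ h1)
  · right
    refine hcomp _ ((Module.End.isUnit_iff _).mp ?_)
    have h2 : e.symm.toLinearMap * f' = 1 - e.symm.toLinearMap * f := by
      rw [eq_sub_iff_add_eq', ← mul_add]
      exact LinearMap.ext fun m => e.symm_apply_apply m
    rw [h2]
    exact h1.isUnit_one_sub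

theorem exists_bijective_of_sum {M : Rep.{w} F G} [Module.Finite F M.V]
    (hM : Indecomposable M) {κ : Type*} (s : Finset κ) {f : κ → Module.End F M.V}
    (hf : ∀ i g m, f i (M.ρ g m) = M.ρ g (f i m)) (h : Function.Bijective (∑ i ∈ s, f i : Module.End F M.V)) :
    ∃ i ∈ s, Function.Bijective (f i) := by
  classical
  induction s using Finset.induction_on with
  | empty =>
    have := (indecomposable_rep_iff.mp hM).1
    obtain ⟨x, hx⟩ := exists_ne (0 : M.V)
    exact absurd (h.1 (by simp)) hx
  | insert a s ha ih =>
    rw [Finset.sum_insert ha] at h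
    rcases bijective_or_bijective_of_add hM (hf a)
      (fun g m => by simp only [LinearMap.sum_apply, hf, map_sum]) h with h1 | h1
    · exact ⟨a, Finset.mem_insert_self a s, h1⟩
    · obtain ⟨i, hi, h2⟩ := ih h1
      exact ⟨i, Finset.mem_insert_of_mem hi, h2⟩

/-- A nonzero direct summand of an indecomposable module is the whole module. -/
theorem nonempty_iso_of_retract {M N : Rep.{w} F G} (hN : Indecomposable N) (hM : Nontrivial M.V)
    (h : Retract M N) : Nonempty (M ≅ N) := by
  rcases (indecomposable_iff.mp hN).2 (h.r ≫ h.i) (by simp) with h0 | h1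
  · exfalso
    refine not_subsingleton_iff_nontrivial.mpr hM ((Rep.isZero_iff _ _ M).mp ?_)
    rw [Limits.IsZero.iff_id_eq_zero]
    have := congrArg (fun f => h.i ≫ f ≫ h.r) h0
    simpa using this
  · exact ⟨⟨h.i, h.r, h.retract, h1⟩⟩

end Indecomposable

/-! ### The subgroups `P`, `Q` and `C` -/

/-- The group-theoretic facts about `Q ≤ P` and a complement `C` of `N_P(Q)` in `N_G(Q)` that the
module theory rests on. -/
structure LocalConfig (p : ℕ) {G : Type*} [Group G] (P Q C : Subgroup G) : Prop where
  normal : P.Normal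
  isPGroup : IsPGroup p P
  le_of_isPGroup (R : Subgroup G) : IsPGroup p R → R ≤ P
  le : Q ≤ P
  le_normalizer : C ≤ Subgroup.normalizer (Q : Set G)
  disjoint : Disjoint Q C
  mem_of_mem_sup (x : G) : x ∈ P → x ∈ Q ⊔ C → x ∈ Q
  exists_of_conj (g : G) : (∀ q ∈ Q, g⁻¹ * q * g ∈ Q ⊔ C) → ∃ x ∈ P, x⁻¹ * g ∈ Q ⊔ C
  not_dvd_card : ¬ p ∣ Nat.card C

theorem localConfig {p : ℕ} [Fact p.Prime] {G : Type*} [Group G] [Finite G] {P : Sylow p G}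
    {Q C : Subgroup G} (hP : (P : Subgroup G).Normal) (hQ : Q ≤ (P : Subgroup G))
    (hC : C ≤ Subgroup.normalizer (Q : Set G))
    (hcompl : ((P : Subgroup G).subgroupOf (Subgroup.normalizer (Q : Set G))).IsComplement'
      (C.subgroupOf (Subgroup.normalizer (Q : Set G)))) : LocalConfig p (P : Subgroup G) Q C where
  normal := hP
  isPGroup := P.isPGroup'
  le_of_isPGroup _ hR := le_sylow_of_normal hP hR
  le := hQ
  le_normalizer := hC
  disjoint := disjoint_of_compl hQ hC hcompl
  mem_of_mem_sup _ := mem_of_mem_sylow_of_mem_sup hQ hC hcompl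
  exists_of_conj _ := exists_mem_sylow_of_conj hQ hC hcompl hP
  not_dvd_card := not_dvd_card_compl hC hcompl hP

namespace LocalConfig

variable {p : ℕ} {G : Type*} [Group G] {P Q C : Subgroup G}

theorem isPGroup_left (h : LocalConfig p P Q C) : IsPGroup p Q := h.isPGroup.to_le h.le

theorem proj_left (h : LocalConfig p P Q C) {q : G} (hq : q ∈ Q) :
    proj Q C h.le_normalizer h.disjoint ⟨q, le_sup_left (a := Q) hq⟩ = 1 := by
  have := normal_subgroupOf_sup h.le_normalizer
  refine (MulEquiv.symm_apply_eq (quotEquiv Q C h.le_normalizer h.disjoint)).mpr ?_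
  rw [map_one]
  exact (QuotientGroup.eq_one_iff _).mpr hq

theorem proj_right (h : LocalConfig p P Q C) (c : C) :
    proj Q C h.le_normalizer h.disjoint ⟨c, le_sup_right (a := Q) c.2⟩ = c := by
  have := normal_subgroupOf_sup h.le_normalizer
  exact (MulEquiv.symm_apply_eq (quotEquiv Q C h.le_normalizer h.disjoint)).mpr rfl

theorem index_subgroupOf (h : LocalConfig p P Q C) : (Q.subgroupOf (Q ⊔ C)).index = Nat.card C :=
  have := normal_subgroupOf_sup h.le_normalizer
  (Nat.card_congr (quotEquiv Q C h.le_normalizer h.disjoint).toEquiv).symm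

/-- There are representatives of the cosets of `QC` on which the translation by elements of `P`
involves only right factors in `Q`. -/
theorem exists_section (h : LocalConfig p P Q C) :
    ∃ s : G ⧸ (Q ⊔ C) → G, (∀ y, (s y : G ⧸ (Q ⊔ C)) = y) ∧
      ∀ x ∈ P, ∀ y, (s (x • y))⁻¹ * (x * s y) ∈ Q := by
  classical
  -- Inside each `P`-orbit the representatives are translates by `P` of a single one.
  let o : G ⧸ (Q ⊔ C) → G ⧸ (Q ⊔ C) := fun y =>
    (Quotient.mk (MulAction.orbitRel P (G ⧸ (Q ⊔ C))) y).out
  have ho : ∀ y, ∃ x : P, x • o y = y := fun y =>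
    MulAction.orbitRel_apply.mp ((MulAction.orbitRel P (G ⧸ (Q ⊔ C))).symm
      (Quotient.mk_out (s := MulAction.orbitRel P (G ⧸ (Q ⊔ C))) y))
  have hox : ∀ (x : P) y, o (x • y) = o y := fun x y =>
    congrArg Quotient.out (Quotient.sound (s := MulAction.orbitRel P (G ⧸ (Q ⊔ C)))
      (MulAction.orbitRel_apply.mpr ⟨x, rfl⟩))
  choose t ht using ho
  have hs : ∀ y, (((t y : G) * (o y).out : G) : G ⧸ (Q ⊔ C)) = y := fun y => by
    conv_rhs => rw [← ht y, ← QuotientGroup.out_eq' (o y)]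
    rfl
  refine ⟨fun y => t y * (o y).out, hs, fun x hx y => h.mem_of_mem_sup _ ?_ ?_⟩
  · have h1 : o (x • y) = o y := hox ⟨x, hx⟩ y
    have h2 := h.normal.conj_mem _ (mul_mem (inv_mem (t (x • y)).2) (mul_mem hx (t y).2))
      (o y).out⁻¹
    change (t (x • y) * (o (x • y)).out)⁻¹ * (x * (t y * (o y).out)) ∈ P
    rw [h1]
    simpa only [mul_inv_rev, mul_assoc, inv_inv] using h2
  · refine QuotientGroup.eq.mp ((hs (x • y)).trans ?_)
    conv_lhs => rw [← hs y]
    rfl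

end LocalConfig

/-! ### The core of a homomorphism between induced modules -/

section Modules

variable {p : ℕ} [Fact p.Prime] {F : Type*} [Field F] [CharP F p] {G : Type*} [Group G] [Finite G]
  {P Q C : Subgroup G} {h : LocalConfig p P Q C}
  {M S M' S' M'' S'' : Type*} [AddCommGroup M] [Module F M] [AddCommGroup S] [Module F S]
  [AddCommGroup M'] [Module F M'] [AddCommGroup S'] [Module F S']
  [AddCommGroup M''] [Module F M''] [AddCommGroup S''] [Module F S'']
  {ρ : Representation F G M} {σ : Representation F C S} {ι : S →ₗ[F] M} {π : M →ₗ[F] S}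
  {ρ' : Representation F G M'} {σ' : Representation F C S'} {ι' : S' →ₗ[F] M'} {π' : M' →ₗ[F] S'}
  {ρ'' : Representation F G M''} {σ'' : Representation F C S''} {ι'' : S'' →ₗ[F] M''}
  {π'' : M'' →ₗ[F] S''}

omit [Fact p.Prime] in
theorem char_nsmul_eq_zero (F : Type*) [Field F] [CharP F p] {V : Type*} [AddCommGroup V]
    [Module F V] (a : V) : p • a = 0 := by
  rw [← Nat.cast_smul_eq_nsmul F, CharP.cast_eq_zero, zero_smul]

/-- `M` is induced from the inflation to `QC` of the `FC`-module `S`. -/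
abbrev IsInflInduced (h : LocalConfig p P Q C) (ρ : Representation F G M)
    (σ : Representation F C S) (ι : S →ₗ[F] M) (π : M →ₗ[F] S) : Prop :=
  IsInduced ρ (σ.comp (proj Q C h.le_normalizer h.disjoint)) ι π

namespace IsInflInduced

omit [Fact p.Prime] [Finite G] [CharP F p] in
theorem ρ_ι (I : IsInflInduced h ρ σ ι π) {q : G} (hq : q ∈ Q) (s : S) : ρ q (ι s) = ι s := by
  have := I.map_ι ⟨q, le_sup_left (a := Q) hq⟩ s
  rw [MonoidHom.comp_apply, h.proj_left hq, map_one] at this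
  exact this.symm

omit [Fact p.Prime] [Finite G] [CharP F p] in
theorem π_ρ (I : IsInflInduced h ρ σ ι π) {q : G} (hq : q ∈ Q) (m : M) : π (ρ q m) = π m := by
  have := I.map_π ⟨q, le_sup_left (a := Q) hq⟩ m
  rwa [MonoidHom.comp_apply, h.proj_left hq, map_one] at this

omit [Fact p.Prime] [Finite G] [CharP F p] in
theorem ι_σ (I : IsInflInduced h ρ σ ι π) (c : C) (s : S) : ι (σ c s) = ρ c (ι s) := by
  have := I.map_ι ⟨c, le_sup_right (a := Q) c.2⟩ s
  rwa [MonoidHom.comp_apply, h.proj_right c] at this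

omit [Fact p.Prime] [Finite G] [CharP F p] in
theorem π_ρ_right (I : IsInflInduced h ρ σ ι π) (c : C) (m : M) : π (ρ c m) = σ c (π m) := by
  have := I.map_π ⟨c, le_sup_right (a := Q) c.2⟩ m
  rwa [MonoidHom.comp_apply, h.proj_right c] at this

end IsInflInduced

/-- The map `s ↦ ∑_{x ∈ P/Q} x ⊗ s` from `S` into the `P`-invariants of `M`. -/
noncomputable def orbitSum (P Q : Subgroup G) (ρ : Representation F G M) (ι : S →ₗ[F] M) :
    S →ₗ[F] M :=
  cosetSum (Q.subgroupOf P) fun x : P => ρ x ∘ₗ ι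

omit [CharP F p] in
theorem orbitSum_apply (s : S) :
    orbitSum P Q ρ ι s = cosetSum (Q.subgroupOf P) fun x : P => ρ x (ι s) :=
  map_cosetSum (LinearMap.applyₗ s) (Q.subgroupOf P) _

namespace IsInflInduced

omit [Fact p.Prime] [Finite G] [CharP F p] in
theorem orbitSum_aux (I : IsInflInduced h ρ σ ι π) (s : S) :
    ∀ x : P, ∀ q ∈ Q.subgroupOf P, ρ ((x * q : P) : G) (ι s) = ρ (x : G) (ι s) := by
  intro x q hq
  rw [Subgroup.coe_mul, map_mul, Module.End.mul_apply]
  exact congrArg _ (I.ρ_ι hq s)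

omit [Fact p.Prime] [CharP F p] in
theorem ρ_orbitSum (I : IsInflInduced h ρ σ ι π) {x : G} (hx : x ∈ P) (s : S) :
    ρ x (orbitSum P Q ρ ι s) = orbitSum P Q ρ ι s := by
  rw [orbitSum_apply, map_cosetSum (ρ x), ← cosetSum_mul_left (F := fun y : P => ρ y (ι s))
    (I.orbitSum_aux s) ⟨x, hx⟩]
  refine cosetSum_congr fun y => ?_
  rw [Subgroup.coe_mul, map_mul, Module.End.mul_apply]

omit [Fact p.Prime] [CharP F p] in
theorem π_orbitSum (I : IsInflInduced h ρ σ ι π) (s : S) : π (orbitSum P Q ρ ι s) = s := by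
  rw [orbitSum_apply, map_cosetSum π, cosetSum_eq_single _ 1]
  · rw [Subgroup.coe_one, map_one, Module.End.one_apply, I.π_ι]
  · intro x hx
    refine I.π_ρ_ι _ (fun hxL => hx ?_) s
    rw [inv_one, one_mul]
    exact h.mem_of_mem_sup x x.2 hxL
  · exact fun x q hq => congrArg π (I.orbitSum_aux s x q hq)

omit [Fact p.Prime] [CharP F p] in
theorem orbitSum_σ (I : IsInflInduced h ρ σ ι π) (c : C) (s : S) :
    orbitSum P Q ρ ι (σ c s) = ρ c (orbitSum P Q ρ ι s) := by
  have := h.normal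
  rw [orbitSum_apply, orbitSum_apply, map_cosetSum (ρ (c : G)), I.ι_σ,
    ← cosetSum_comp_mulEquiv (φ := MulAut.conjNormal (c : G))]
  · refine cosetSum_congr fun x => ?_
    rw [MulAut.conjNormal_apply, ← Module.End.mul_apply, ← Module.End.mul_apply, ← map_mul,
      ← map_mul, inv_mul_cancel_right]
  · intro x q hq
    rw [← I.ι_σ]
    exact I.orbitSum_aux _ x q hq
  · intro x
    rw [Subgroup.mem_subgroupOf, Subgroup.mem_subgroupOf, MulAut.conjNormal_apply]
    exact Subgroup.mem_normalizer_iff.mp (h.le_normalizer c.2) x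

/-- On `P`-invariants `m` of `M`, the component at `1` of `f m` depends only on the component at
`1` of `m`: the cosets `gQC` outside `P` contribute multiples of `p`. -/
theorem π_apply_of_invariant (I : IsInflInduced h ρ σ ι π) (I' : IsInflInduced h ρ' σ' ι' π')
    {f : M →ₗ[F] M'} (hf : ∀ g m, f (ρ g m) = ρ' g (f m)) {m : M} (hm : ∀ x ∈ P, ρ x m = m) :
    π' (f m) = π' (f (orbitSum P Q ρ ι (π m))) := by
  conv_lhs => rw [← I.sum m]
  rw [map_cosetSum f, map_cosetSum π', cosetSum_eq_cosetSum_subgroup (char_nsmul_eq_zero F)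
    h.isPGroup_left h.le le_sup_left h.mem_of_mem_sup h.exists_of_conj, orbitSum_apply,
    map_cosetSum f, map_cosetSum π']
  · refine cosetSum_congr fun x => ?_
    rw [hm _ (inv_mem x.2)]
  · intro g l hl
    exact congrArg (fun y => π' (f y))
      (LinearMap.congr_fun (conj_mul_of_mem I.comp_equivariant g hl) m)
  · intro q hq g
    rw [mul_inv_rev, map_mul, map_mul, Module.End.mul_apply, Module.End.mul_apply,
      hm _ (inv_mem (h.le hq)), hf q, I'.π_ρ hq]

end IsInflInduced

/-- The core `S → S'` of an `FG`-homomorphism `f : M → M'` between modules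
induced from the inflations of `S` and `S'`: it sends `s` to the component at `1` of
`f (∑_{x ∈ P/Q} x ⊗ s)`. -/
noncomputable def core (P Q : Subgroup G) (ρ : Representation F G M) (ι : S →ₗ[F] M)
    (π' : M' →ₗ[F] S') (f : M →ₗ[F] M') : S →ₗ[F] S' :=
  π' ∘ₗ f ∘ₗ orbitSum P Q ρ ι

namespace IsInflInduced

omit [Fact p.Prime] [CharP F p] in
theorem core_equivariant (I : IsInflInduced h ρ σ ι π) (I' : IsInflInduced h ρ' σ' ι' π')
    {f : M →ₗ[F] M'} (hf : ∀ g m, f (ρ g m) = ρ' g (f m)) (c : C) (s : S) :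
    core P Q ρ ι π' f (σ c s) = σ' c (core P Q ρ ι π' f s) := by
  simp only [core, LinearMap.comp_apply]
  rw [I.orbitSum_σ, hf, I'.π_ρ_right]

omit [Fact p.Prime] [CharP F p] in
theorem core_id (I : IsInflInduced h ρ σ ι π) : core P Q ρ ι π LinearMap.id = LinearMap.id :=
  LinearMap.ext I.π_orbitSum

theorem core_comp (I : IsInflInduced h ρ σ ι π) (I' : IsInflInduced h ρ' σ' ι' π')
    (I'' : IsInflInduced h ρ'' σ'' ι'' π'') {f : M →ₗ[F] M'} {f' : M' →ₗ[F] M''}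
    (hf : ∀ g m, f (ρ g m) = ρ' g (f m)) (hf' : ∀ g m, f' (ρ' g m) = ρ'' g (f' m)) :
    core P Q ρ ι π'' (f' ∘ₗ f) = core P Q ρ' ι' π'' f' ∘ₗ core P Q ρ ι π' f := by
  ext s
  refine I'.π_apply_of_invariant I'' hf' fun x hx => ?_
  rw [← hf, I.ρ_orbitSum hx]

/-- An idempotent endomorphism whose core vanishes is zero: it kills all `P`-invariants of `M`,
but every nonzero submodule contains nonzero `P`-invariants. -/
theorem eq_zero_of_core_eq_zero (I : IsInflInduced h ρ σ ι π) {e : M →ₗ[F] M}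
    (he : ∀ g m, e (ρ g m) = ρ g (e m)) (hee : e ∘ₗ e = e) (h0 : core P Q ρ ι π e = 0) :
    e = 0 := by
  have hinv : ∀ m, (∀ x ∈ P, ρ x m = m) → e m = 0 := by
    intro m hm
    rw [← I.sum (e m)]
    refine (cosetSum_congr fun g => ?_).trans ((cosetSum_const _ 0).trans (smul_zero _))
    rw [← he, I.π_apply_of_invariant I he (m := ρ g⁻¹ m)]
    · rw [show π (e (orbitSum P Q ρ ι (π (ρ g⁻¹ m)))) = core P Q ρ ι π e (π (ρ g⁻¹ m)) from rfl,
        h0, LinearMap.zero_apply, map_zero, map_zero]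
    · intro x hx
      have h1 := hm _ (h.normal.conj_mem x hx g)
      rw [← Module.End.mul_apply, ← map_mul]
      conv_rhs => rw [← h1]
      rw [← Module.End.mul_apply, ← map_mul]
      congr 2
      group
  by_contra hne
  obtain ⟨m, hm⟩ : ∃ m, e m ≠ 0 := by
    by_contra! hcon
    exact hne (LinearMap.ext hcon)
  let : DistribMulAction P M :=
    { smul := fun x m => ρ (x : G) m
      one_smul := fun m => by
        change ρ ((1 : P) : G) m = m
        rw [Subgroup.coe_one, map_one, Module.End.one_apply]
      mul_smul := fun x y m => by
        change ρ ((x * y : P) : G) m = ρ (x : G) (ρ (y : G) m)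
        rw [Subgroup.coe_mul, map_mul, Module.End.mul_apply]
      smul_zero := fun x => map_zero (ρ (x : G))
      smul_add := fun x => map_add (ρ (x : G)) }
  obtain ⟨n, hn, hn0, hfix⟩ := exists_fixed_ne_zero (char_nsmul_eq_zero F) h.isPGroup hm
  have hen : e n = n := by
    have hle : AddSubgroup.closure (Set.range fun x : P => x • e m) ≤
        (LinearMap.eqLocus e LinearMap.id).toAddSubgroup := by
      rw [AddSubgroup.closure_le]
      rintro _ ⟨x, rfl⟩
      change e (ρ (x : G) (e m)) = ρ (x : G) (e m)
      rw [he, ← LinearMap.comp_apply e e, hee]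
    exact hle hn
  exact hn0 (hen.symm.trans (hinv n fun x hx => hfix ⟨x, hx⟩))

omit [Fact p.Prime] [CharP F p] [Finite G] in
theorem ι_injective (I : IsInflInduced h ρ σ ι π) : Function.Injective ι :=
  Function.LeftInverse.injective I.π_ι

/-- The core of an idempotent is an idempotent endomorphism of the simple module `S`, hence zero or
the identity. -/
theorem eq_zero_or_eq_id (I : IsInflInduced h ρ σ ι π) (hσ : σ.IsIrreducible) {e : M →ₗ[F] M}
    (he : ∀ g m, e (ρ g m) = ρ g (e m)) (hee : e ∘ₗ e = e) : e = 0 ∨ e = LinearMap.id := by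
  let ε : σ.IntertwiningMap σ :=
    ⟨core P Q ρ ι π e, fun c => LinearMap.ext (I.core_equivariant I he c)⟩
  have hεε : core P Q ρ ι π e ∘ₗ core P Q ρ ι π e = core P Q ρ ι π e := by
    rw [← I.core_comp I I he he, hee]
  rcases Representation.IsIrreducible.injective_or_eq_zero ε with hinj | h0
  · right
    have hid : core P Q ρ ι π e = LinearMap.id :=
      LinearMap.ext fun s => hinj (LinearMap.congr_fun hεε s)
    refine (sub_eq_zero.mp (I.eq_zero_of_core_eq_zero (e := LinearMap.id - e) ?_ ?_ ?_)).symm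
    · intro g m
      simp only [LinearMap.sub_apply, LinearMap.id_apply, he, map_sub]
    · rw [LinearMap.sub_comp, LinearMap.comp_sub, LinearMap.comp_sub, hee]
      simp
    · have : core P Q ρ ι π (LinearMap.id - e) =
          core P Q ρ ι π LinearMap.id - core P Q ρ ι π e := by
        simp only [core, LinearMap.sub_comp, LinearMap.comp_sub]
      rw [this, I.core_id, hid, sub_self]
  · left
    exact I.eq_zero_of_core_eq_zero he hee (congrArg (fun f => f.toLinearMap) h0)

end IsInflInduced

omit [Finite G] in
theorem nontrivial_of_isIrreducible (hσ : σ.IsIrreducible) : Nontrivial S := by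
  rw [← not_subsingleton_iff_nontrivial]
  intro hS
  obtain ⟨N, N', hN⟩ := exists_pair_ne (Subrepresentation σ)
  exact hN (Subrepresentation.toSubmodule_injective (Subsingleton.elim _ _))

theorem finite_of_isIrreducible (hσ : σ.IsIrreducible) : Module.Finite F S := by
  have := nontrivial_of_isIrreducible hσ
  obtain ⟨s, hs⟩ := exists_ne (0 : S)
  let N : Subrepresentation σ :=
    { toSubmodule := Submodule.span F (Set.range fun c => σ c s)
      apply_mem_toSubmodule := fun c v hv => by
        have hle : Submodule.span F (Set.range fun c => σ c s) ≤
            (Submodule.span F (Set.range fun c => σ c s)).comap (σ c) := by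
          rw [Submodule.span_le]
          rintro _ ⟨d, rfl⟩
          refine Submodule.subset_span ⟨c * d, ?_⟩
          simp only [map_mul, Module.End.mul_apply]
        exact hle hv }
  have hsN : s ∈ N.toSubmodule := Submodule.subset_span ⟨1, by simp⟩
  have hN : N = ⊤ := (eq_bot_or_eq_top N).resolve_left fun hb => hs (by
    rw [hb] at hsN
    exact hsN)
  have htop : Submodule.span F (Set.range fun c => σ c s) = ⊤ :=
    congrArg Subrepresentation.toSubmodule hN
  exact ⟨(Submodule.fg_def).mpr ⟨_, Set.finite_range _, htop⟩⟩

end Modules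

/-! ### Modules induced from inflated simple modules -/

section Reps

variable {p : ℕ} [Fact p.Prime] {F : Type u} [Field F] [CharP F p] {G : Type v} [Group G]
  [Finite G] {P Q C : Subgroup G} {h : LocalConfig p P Q C}

omit [Fact p.Prime] [CharP F p] in
theorem exists_isInflInduced (h : LocalConfig p P Q C) (S : Rep.{max u v w} F C) :
    ∃ ι π, IsInflInduced h
      ((inflInd.{u, v, w} F Q C h.le_normalizer h.disjoint).obj S).ρ S.ρ ι π :=
  exists_isInduced_ind (S.ρ.comp (proj Q C h.le_normalizer h.disjoint))

variable {S : Type*} [AddCommGroup S] [Module F S] {σ : Representation F C S}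

theorem IsInflInduced.indecomposable {M : Rep.{w} F G} {ι : S →ₗ[F] M.V} {π : M.V →ₗ[F] S}
    (I : IsInflInduced h M.ρ σ ι π) (hσ : σ.IsIrreducible) : Indecomposable M := by
  have := nontrivial_of_isIrreducible hσ
  exact indecomposable_rep_iff.mpr
    ⟨I.ι_injective.nontrivial, fun e he hee => I.eq_zero_or_eq_id hσ he hee⟩

theorem IsInflInduced.isVertex {M : Rep.{max u v w} F G} {ι : S →ₗ[F] M.V} {π : M.V →ₗ[F] S}
    (I : IsInflInduced h M.ρ σ ι π) (hS : Nontrivial S) : IsVertex.{u, v, w} M Q := by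
  refine ⟨isRelProjective_iff.mpr ?_, fun R hR hRQ => ?_⟩
  · -- The trace of `ι π` from `Q` to `QC` is `|C| ι π`, and `|C|` is invertible.
    have hc : (Nat.card C : F) ≠ 0 := fun h0 =>
      h.not_dvd_card ((CharP.cast_eq_zero_iff F p _).mp h0)
    have heq : ∀ g ∈ Q ⊔ C, ∀ m, ((Nat.card C : F)⁻¹ • (ι ∘ₗ π)) (M.ρ g m) =
        M.ρ g (((Nat.card C : F)⁻¹ • (ι ∘ₗ π)) m) := fun g hg m => by
      rw [LinearMap.smul_apply, LinearMap.smul_apply, I.comp_equivariant g hg, map_smul]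
    refine ⟨(Nat.card C : F)⁻¹ • (ι ∘ₗ π), fun g hg => heq g (le_sup_left (a := Q) hg), ?_⟩
    rw [relTrace_of_le (le_sup_left : Q ≤ Q ⊔ C) fun g hg => heq g (le_sup_left (a := Q) hg),
      ← I.relTrace_eq_id]
    congr 1
    ext m
    rw [relTrace_apply]
    refine (cosetSum_congr (F' := fun _ => (Nat.card C : F)⁻¹ • (ι ∘ₗ π) m) fun l => ?_).trans ?_
    · change M.ρ l (((Nat.card C : F)⁻¹ • (ι ∘ₗ π)) (M.ρ (l : G)⁻¹ m)) = _
      rw [← heq _ l.2, Representation.self_inv_apply]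
      rfl
    · rw [cosetSum_const, h.index_subgroupOf, ← Nat.cast_smul_eq_nsmul F, smul_smul,
        mul_inv_cancel₀ hc, one_smul]
  · -- Evaluating the component at `1` of `∑_{g ∈ G/R} g α g⁻¹` on `1 ⊗ s` gives a sum of a
    -- `Q`-invariant function over `G / R`.
    obtain ⟨α, hα, htr⟩ := isRelProjective_iff.mp hR
    by_contra hQR
    have hlt : R < Q := lt_of_le_not_ge hRQ hQR
    obtain ⟨s, hs⟩ := exists_ne (0 : S)
    refine hs ?_
    have h1 : π (relTrace R M.ρ M.ρ α (ι s)) = s := by rw [htr, LinearMap.id_apply, I.π_ι]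
    rw [← h1, relTrace_apply, map_cosetSum π]
    refine cosetSum_eq_zero_of_lt (char_nsmul_eq_zero F) h.isPGroup_left hlt ?_ ?_
    · intro g r hr
      exact congrArg π (LinearMap.congr_fun (conj_mul_of_mem hα g hr) (ι s))
    · intro q hq g
      rw [mul_inv_rev, map_mul, map_mul, Module.End.mul_apply, Module.End.mul_apply,
        I.ρ_ι (inv_mem hq), I.π_ρ hq]

omit [Fact p.Prime] [CharP F p] in
theorem IsInflInduced.isPPermutation {M : Rep.{w} F G} {ι : S →ₗ[F] M.V} {π : M.V →ₗ[F] S}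
    (I : IsInflInduced h M.ρ σ ι π) [Module.Finite F S] : IsPPermutation p M := by
  classical
  obtain ⟨t, ht, htP⟩ := h.exists_section
  have := Fintype.ofFinite (G ⧸ (Q ⊔ C))
  -- The decomposition of `M` as the direct sum of the translates `t y ⊗ S`.
  let e : M.V ≃ₗ[F] (G ⧸ (Q ⊔ C) → S) :=
    { toFun := fun m y => π (M.ρ (t y)⁻¹ m)
      invFun := fun f => ∑ y, M.ρ (t y) (ι (f y))
      map_add' := fun m m' => funext fun y => by simp
      map_smul' := fun a m => funext fun y => by simp
      left_inv := fun m => by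
        have h1 := I.sum m
        rw [cosetSum, finsum_eq_sum_of_fintype] at h1
        conv_rhs => rw [← h1]
        refine Finset.sum_congr rfl fun y _ => ?_
        have h2 := apply_out (F := fun g => M.ρ g (ι (π (M.ρ g⁻¹ m)))) (fun g l hl =>
          LinearMap.congr_fun (conj_mul_of_mem I.comp_equivariant g hl) m) (t y)
        rw [ht] at h2
        exact h2.symm
      right_inv := fun f => funext fun y => by
        change π (M.ρ (t y)⁻¹ (∑ z, M.ρ (t z) (ι (f z)))) = f y
        rw [map_sum, map_sum, Finset.sum_eq_single y]
        · rw [Representation.inv_self_apply, I.π_ι]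
        · intro z _ hz
          rw [← Module.End.mul_apply, ← map_mul]
          refine I.π_ρ_ι _ (fun hmem => hz ?_) _
          rw [← ht z, ← ht y]
          exact (QuotientGroup.eq.mpr hmem).symm
        · exact fun hy => absurd (Finset.mem_univ y) hy }
  have hfin : Module.Finite F M.V := Module.Finite.equiv e.symm
  refine ⟨hfin, fun R hR => ?_⟩
  let b := Module.finBasis F S
  let B := ((Pi.basis fun _ : G ⧸ (Q ⊔ C) => b).map e.symm)
  have hB : ∀ y j, B ⟨y, j⟩ = M.ρ (t y) (ι (b j)) := by
    intro y j
    change ∑ z, M.ρ (t z) (ι ((Pi.basis fun _ : G ⧸ (Q ⊔ C) => b) ⟨y, j⟩ z)) = _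
    rw [Finset.sum_eq_single y]
    · rw [Pi.basis_apply, Pi.single_eq_same]
    · intro z _ hz
      rw [Pi.basis_apply, Pi.single_eq_of_ne hz, map_zero, map_zero]
    · exact fun hy => absurd (Finset.mem_univ y) hy
  let E := Finite.equivFin (Σ _ : G ⧸ (Q ⊔ C), Fin (Module.finrank F S))
  refine ⟨_, B.reindex E, fun r hr i => ?_⟩
  obtain ⟨⟨y, j⟩, rfl⟩ := E.surjective i
  refine ⟨E ⟨r • y, j⟩, ?_⟩
  rw [Module.Basis.reindex_apply, Module.Basis.reindex_apply, Equiv.symm_apply_apply,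
    Equiv.symm_apply_apply, hB, hB]
  have hq := htP r (h.le_of_isPGroup R hR hr) y
  conv_rhs => rw [← I.ρ_ι hq (b j)]
  rw [← Module.End.mul_apply, ← Module.End.mul_apply, ← map_mul, ← map_mul, mul_inv_cancel_left]

/-- The core of an isomorphism `M_S ≅ M_{S'}` is an isomorphism `S ≅ S'`. -/
theorem nonempty_iso_of_inflInd_iso (h : LocalConfig p P Q C) {S S' : Rep.{max u v w} F C}
    (i : (inflInd.{u, v, w} F Q C h.le_normalizer h.disjoint).obj S ≅
      (inflInd.{u, v, w} F Q C h.le_normalizer h.disjoint).obj S') : Nonempty (S ≅ S') := by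
  obtain ⟨ι, π, I⟩ := exists_isInflInduced h S
  obtain ⟨ι', π', I'⟩ := exists_isInflInduced h S'
  have hf := fun g m => Rep.hom_comm_apply i.hom g m
  have hf' := fun g m => Rep.hom_comm_apply i.inv g m
  have h1 := I.core_comp I' I (f := i.hom.hom.toLinearMap) (f' := i.inv.hom.toLinearMap) hf hf'
  have h2 := I'.core_comp I I' (f := i.inv.hom.toLinearMap) (f' := i.hom.hom.toLinearMap) hf' hf
  have hid : i.inv.hom.toLinearMap ∘ₗ i.hom.hom.toLinearMap = LinearMap.id := by
    rw [← Rep.hom_comp_toLinearMap, i.hom_inv_id]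
    rfl
  have hid' : i.hom.hom.toLinearMap ∘ₗ i.inv.hom.toLinearMap = LinearMap.id := by
    rw [← Rep.hom_comp_toLinearMap, i.inv_hom_id]
    rfl
  rw [hid, I.core_id] at h1
  rw [hid', I'.core_id] at h2
  exact ⟨⟨Rep.ofHom ⟨core P Q _ ι π' i.hom.hom.toLinearMap, fun c =>
      LinearMap.ext (I.core_equivariant I' hf c)⟩,
    Rep.ofHom ⟨core P Q _ ι' π i.inv.hom.toLinearMap, fun c =>
      LinearMap.ext (I'.core_equivariant I hf' c)⟩,
    Rep.hom_ext (Representation.IntertwiningMap.ext h1.symm),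
    Rep.hom_ext (Representation.IntertwiningMap.ext h2.symm)⟩⟩

end Reps

/-! ### Indecomposable `p`-permutation modules with a given vertex -/

section Surjectivity

variable {p : ℕ} [Fact p.Prime] {F : Type u} [Field F] [CharP F p] {G : Type v} [Group G]
  [Finite G] {P Q C : Subgroup G}

omit [Finite G] in
theorem exists_equivariant_inverse {M : Type*} [AddCommGroup M] [Module F M]
    {ρ : Representation F G M} {f : M →ₗ[F] M} (hf : ∀ g m, f (ρ g m) = ρ g (f m))
    (h : Function.Bijective f) :
    ∃ f' : M →ₗ[F] M, (∀ g m, f' (ρ g m) = ρ g (f' m)) ∧ f ∘ₗ f' = LinearMap.id := by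
  let e := LinearEquiv.ofBijective f h
  refine ⟨e.symm.toLinearMap, fun g m => ?_, LinearMap.ext e.apply_symm_apply⟩
  change e.symm (ρ g m) = ρ g (e.symm m)
  rw [LinearEquiv.symm_apply_eq]
  change ρ g m = f (ρ g (e.symm m))
  rw [hf]
  exact congrArg _ (e.apply_symm_apply m).symm

theorem isRelProjective_of_bijective {M : Rep.{max u v w} F G} {R : Subgroup G}
    {f : M.V →ₗ[F] M.V} (hf : ∀ r ∈ R, ∀ m, f (M.ρ r m) = M.ρ r (f m))
    (h : Function.Bijective (relTrace R M.ρ M.ρ f)) : IsRelProjective.{u, v, w} M R := by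
  obtain ⟨f', hf', hff'⟩ := exists_equivariant_inverse (relTrace_equivariant hf) h
  refine isRelProjective_iff.mpr ⟨f ∘ₗ f', fun r hr m => ?_, ?_⟩
  · rw [LinearMap.comp_apply, LinearMap.comp_apply, hf', hf r hr]
  · rw [← relTrace_comp f hf', hff']

/-- If the identity of an indecomposable module is a trace from `Q` and `Q` permutes a basis, then
some basis vector `b i` with stabilizer `R` in `Q` already gives an automorphism which is the trace
from `R` of an endomorphism of rank one onto the line of `b i`: the identity is a sum of such
traces, over the orbits of `Q` on the basis. -/
theorem exists_stabilizer {M : Rep.{w} F G} [Module.Finite F M.V] (hM : Indecomposable M)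
    {n : ℕ} (b : Module.Basis (Fin n) F M.V) (hb : ∀ q ∈ Q, ∀ i, ∃ j, M.ρ q (b i) = b j)
    {α : M.V →ₗ[F] M.V} (hα : ∀ q ∈ Q, ∀ m, α (M.ρ q m) = M.ρ q (α m))
    (htr : relTrace Q M.ρ M.ρ α = LinearMap.id) :
    ∃ i, ∃ R ≤ Q, (∀ r ∈ R, M.ρ r (b i) = b i) ∧
      (∀ r ∈ R, ∀ m, b.coord i (α (M.ρ r m)) = b.coord i (α m)) ∧
      Function.Bijective (relTrace R M.ρ M.ρ ((b.coord i ∘ₗ α).smulRight (b i))) := by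
  classical
  choose a ha using fun (q : Q) i => hb q q.2 i
  let act : MulAction Q (Fin n) :=
    { smul := a
      one_smul := fun i => b.injective (by
        change b (a 1 i) = b i
        rw [← ha, Subgroup.coe_one, map_one, Module.End.one_apply])
      mul_smul := fun q q' i => b.injective (by
        change b (a (q * q') i) = b (a q (a q' i))
        rw [← ha, ← ha, ← ha, Subgroup.coe_mul, map_mul, Module.End.mul_apply]) }
  have hact : ∀ (q : Q) i, M.ρ q (b i) = b (q • i) := ha
  have hcoord : ∀ (q : Q) i m, b.coord (q • i) (M.ρ q m) = b.coord i m := by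
    intro q i m
    refine LinearMap.congr_fun (f := b.coord (q • i) ∘ₗ M.ρ q) (g := b.coord i) ?_ m
    refine b.ext fun j => ?_
    rw [LinearMap.comp_apply, hact, Module.Basis.coord_apply, Module.Basis.coord_apply,
      Module.Basis.repr_self, Module.Basis.repr_self, Finsupp.single_apply, Finsupp.single_apply]
    simp only [smul_left_cancel_iff]
  let f : Fin n → M.V →ₗ[F] M.V := fun i => (b.coord i ∘ₗ α).smulRight (b i)
  have hf : ∀ (q : Q) i m, f (q • i) (M.ρ q m) = M.ρ q (f i m) := by
    intro q i m
    change b.coord (q • i) (α (M.ρ q m)) • b (q • i) = M.ρ q (b.coord i (α m) • b i)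
    rw [hα q q.2, hcoord, LinearMap.map_smul, hact]
  have hfα : ∑ i, f i = α := by
    ext m
    rw [LinearMap.sum_apply]
    exact b.sum_repr (α m)
  let mk : Fin n → MulAction.orbitRel.Quotient Q (Fin n) := Quotient.mk _
  -- The sum of the `f j` over the orbit of `i` is a trace from the stabilizer of `i`.
  have horb : ∀ i, ∑ j with mk j = mk i, f j = relTrace (MulAction.stabilizer Q i)
      (M.ρ.comp Q.subtype) (M.ρ.comp Q.subtype) (f i) := by
    intro i
    have h1 : relTrace (MulAction.stabilizer Q i) (M.ρ.comp Q.subtype) (M.ρ.comp Q.subtype) (f i) =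
        ∑ᶠ z : MulAction.orbit Q i, f z := by
      rw [← finsum_comp_equiv (MulAction.orbitEquivQuotientStabilizer Q i).symm]
      refine finsum_congr fun y => ?_
      conv_rhs => rw [← QuotientGroup.out_eq' y]
      rw [MulAction.orbitEquivQuotientStabilizer_symm_apply]
      ext m
      change M.ρ (y.out : Q) (f i (M.ρ ((y.out⁻¹ : Q) : G) m)) = _
      rw [← hf, Subgroup.coe_inv, Representation.self_inv_apply]
    rw [h1, finsum_set_coe_eq_finsum_mem, ← finsum_mem_coe_finset]
    refine finsum_mem_congr (Set.ext fun j => ?_) fun _ _ => rfl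
    rw [Finset.mem_coe, Finset.mem_filter, and_iff_right (Finset.mem_univ j)]
    exact Quotient.eq.trans MulAction.orbitRel_apply
  have hfstab : ∀ i, ∀ q ∈ MulAction.stabilizer Q i, ∀ m,
      f i ((M.ρ.comp Q.subtype) q m) = (M.ρ.comp Q.subtype) q (f i m) := by
    intro i q hq m
    have h1 := hf q i m
    rwa [MulAction.mem_stabilizer_iff.mp hq] at h1
  have hforb : ∀ i, ∀ q ∈ Q, ∀ m, (∑ j with mk j = mk i, f j) (M.ρ q m) =
      M.ρ q ((∑ j with mk j = mk i, f j) m) := by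
    intro i q hq m
    rw [horb]
    exact relTrace_equivariant (hfstab i) ⟨q, hq⟩ m
  have hsum : ∑ ω : MulAction.orbitRel.Quotient Q (Fin n),
      relTrace Q M.ρ M.ρ (∑ j with mk j = ω, f j) = LinearMap.id := by
    rw [← relTrace_finset_sum, Finset.sum_fiberwise, hfα, htr]
  obtain ⟨ω, -, hω⟩ := exists_bijective_of_sum hM Finset.univ
    (f := fun ω => relTrace Q M.ρ M.ρ (∑ j with mk j = ω, f j)) (fun ω => by
      obtain ⟨i, rfl⟩ := Quotient.exists_rep ω
      exact relTrace_equivariant (hforb i)) (by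
      rw [hsum]
      exact Function.bijective_id)
  obtain ⟨i, rfl⟩ := Quotient.exists_rep ω
  have hsub : ((MulAction.stabilizer Q i).map Q.subtype).subgroupOf Q =
      MulAction.stabilizer Q i :=
    Subgroup.comap_map_eq_self_of_injective Q.subtype_injective _
  have hle : (MulAction.stabilizer Q i).map Q.subtype ≤ Q := Subgroup.map_subtype_le _
  refine ⟨i, (MulAction.stabilizer Q i).map Q.subtype, hle, ?_, ?_, ?_⟩
  · rintro _ ⟨q, hq, rfl⟩
    rw [Subgroup.subtype_apply, hact, MulAction.mem_stabilizer_iff.mp hq]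
  · rintro _ ⟨q, hq, rfl⟩ m
    have h1 := hcoord q i (α m)
    rw [MulAction.mem_stabilizer_iff.mp hq] at h1
    rw [Subgroup.subtype_apply, hα q q.2, h1]
  · rw [relTrace_of_le hle, hsub]
    · have := horb i
      rw [show (b.coord i ∘ₗ α).smulRight (b i) = f i from rfl, ← this]
      exact hω
    · rintro _ ⟨q, hq, rfl⟩ m
      exact hfstab i q hq m

omit [Fact p.Prime] [CharP F p] in
/-- An indecomposable `p`-permutation module with vertex `Q` has an automorphism which is the trace
from `Q` of a map `m ↦ l(m) x` with `Q`-invariant `x` and `l`. -/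
theorem IsIndecPPermWithVertex.exists_invariant {M : Rep.{max u v w} F G}
    (hM : IsIndecPPermWithVertex.{u, v, w} p Q M) (hQ : IsPGroup p Q) :
    ∃ (x : M.V) (l : M.V →ₗ[F] F), (∀ q ∈ Q, M.ρ q x = x) ∧ (∀ q ∈ Q, ∀ m, l (M.ρ q m) = l m) ∧
      Function.Bijective (relTrace Q M.ρ M.ρ (l.smulRight x)) := by
  obtain ⟨hind, ⟨hfin, hbasis⟩, hrel, hmin⟩ := hM
  obtain ⟨n, b, hb⟩ := hbasis Q hQ
  obtain ⟨α, hα, htr⟩ := isRelProjective_iff.mp hrel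
  obtain ⟨i, R, hRQ, hRb, hRl, hbij⟩ := exists_stabilizer hind b hb hα htr
  have hproj : IsRelProjective.{u, v, w} M R := isRelProjective_of_bijective (fun r hr m => by
    rw [LinearMap.smulRight_apply, LinearMap.smulRight_apply, LinearMap.comp_apply,
      LinearMap.comp_apply, hRl r hr, map_smul, hRb r hr]) hbij
  obtain rfl : R = Q := le_antisymm hRQ (hmin hproj hRQ)
  exact ⟨b i, b.coord i ∘ₗ α, hRb, hRl, hbij⟩

/-- Every indecomposable `p`-permutation module with vertex `Q` is induced from the inflation to
`QC` of a simple `FC`-module. The simple module is the image of a `QC`-endomorphism with values in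
the `Q`-invariants of `M` whose trace is an automorphism, chosen of minimal rank. -/
theorem IsIndecPPermWithVertex.exists_iso (h : LocalConfig p P Q C) {M : Rep.{max u v w} F G}
    (hM : IsIndecPPermWithVertex.{u, v, w} p Q M) :
    ∃ S : Rep.{max u v w} F C, S.ρ.IsIrreducible ∧
      Nonempty ((inflInd.{u, v, w} F Q C h.le_normalizer h.disjoint).obj S ≅ M) := by
  classical
  obtain ⟨x, l, hx, hl, hbij⟩ := hM.exists_invariant h.isPGroup_left
  have hind := hM.1
  have hfin := hM.2.1.1
  have hnt := (indecomposable_rep_iff.mp hind).1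
  let X : Set (M.V →ₗ[F] M.V) := {β | (∀ g ∈ Q ⊔ C, ∀ m, β (M.ρ g m) = M.ρ g (β m)) ∧
    (∀ q ∈ Q, ∀ m, M.ρ q (β m) = β m) ∧ Function.Bijective (relTrace (Q ⊔ C) M.ρ M.ρ β)}
  have hX : X.Nonempty := by
    have hf : ∀ q ∈ Q, ∀ m, l.smulRight x (M.ρ q m) = M.ρ q (l.smulRight x m) := fun q hq m => by
      rw [LinearMap.smulRight_apply, LinearMap.smulRight_apply, hl q hq, map_smul, hx q hq]
    refine ⟨relTrace (Q.subgroupOf (Q ⊔ C)) (M.ρ.comp (Q ⊔ C).subtype)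
      (M.ρ.comp (Q ⊔ C).subtype) (l.smulRight x), fun g hg m => ?_, fun q hq m => ?_, ?_⟩
    · exact relTrace_equivariant (ρ := M.ρ.comp (Q ⊔ C).subtype)
        (σ := M.ρ.comp (Q ⊔ C).subtype) (fun q hq m => hf q hq m) ⟨g, hg⟩ m
    · rw [relTrace_apply, map_cosetSum (M.ρ q)]
      refine cosetSum_congr fun g => ?_
      have hn : (g : G)⁻¹ * q * g ∈ Q :=
        (Subgroup.mem_normalizer_iff''.mp ((sup_le Subgroup.le_normalizer h.le_normalizer) g.2)
          q).mp hq
      rw [LinearMap.smulRight_apply, map_smul, map_smul]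
      congr 1
      change M.ρ q (M.ρ g x) = M.ρ g x
      conv_rhs => rw [← hx _ hn]
      rw [← Module.End.mul_apply, ← Module.End.mul_apply, ← map_mul, ← map_mul]
      congr 2
      group
    · rwa [← relTrace_of_le le_sup_left hf]
  obtain ⟨β, ⟨hβ, hβQ, hβbij⟩, hmin⟩ := (InvImage.wf
    (fun β : M.V →ₗ[F] M.V => Module.finrank F (LinearMap.range β)) Nat.lt_wfRel.wf).has_min X hX
  let W : Subrepresentation (M.ρ.comp C.subtype) :=
    { toSubmodule := LinearMap.range β
      apply_mem_toSubmodule := by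
        rintro c _ ⟨m, rfl⟩
        exact ⟨M.ρ c m, hβ c (le_sup_right (a := Q) c.2) m⟩ }
  -- `QC` acts on the image of `β` through the projection to `C`.
  have hW : ∀ (g : ↥(Q ⊔ C)) (s : LinearMap.range β), M.ρ g s =
      (W.toRepresentation (proj Q C h.le_normalizer h.disjoint g) s : LinearMap.range β) := by
    rintro ⟨g, hg⟩ s
    obtain ⟨q, hq, c, hc, rfl⟩ := (mem_sup_iff_exists h.le_normalizer).mp hg
    have h1 : (⟨q * c, hg⟩ : ↥(Q ⊔ C)) =
      ⟨q, le_sup_left (a := Q) hq⟩ * ⟨c, le_sup_right (a := Q) hc⟩ := rfl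
    rw [h1, map_mul, h.proj_left hq, h.proj_right ⟨c, hc⟩, one_mul]
    change M.ρ (q * c) s = M.ρ c s
    obtain ⟨_, m, rfl⟩ := s
    rw [map_mul, Module.End.mul_apply, ← hβ c (le_sup_right (a := Q) hc), hβQ q hq]
  have hβW : ∀ (g : ↥(Q ⊔ C)) m, β.rangeRestrict (M.ρ g m) =
      W.toRepresentation (proj Q C h.le_normalizer h.disjoint g) (β.rangeRestrict m) :=
    fun g m => Subtype.ext ((hβ g g.2 m).trans (hW g (β.rangeRestrict m)))
  -- The composite of `β` with an endomorphism `E` of its image.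
  let βE : (LinearMap.range β →ₗ[F] LinearMap.range β) → M.V →ₗ[F] M.V := fun E =>
    (LinearMap.range β).subtype ∘ₗ E ∘ₗ β.rangeRestrict
  have hβE : ∀ E : LinearMap.range β →ₗ[F] LinearMap.range β,
      (∀ (c : C) s, E (W.toRepresentation c s) = W.toRepresentation c (E s)) →
      ∀ g ∈ Q ⊔ C, ∀ m, βE E (M.ρ g m) = M.ρ g (βE E m) := by
    intro E hE g hg m
    change ((E (β.rangeRestrict (M.ρ g m)) : LinearMap.range β) : M.V) = _
    rw [hβW ⟨g, hg⟩, hE]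
    exact (hW ⟨g, hg⟩ _).symm
  have key : ∀ (N : Submodule F (LinearMap.range β)) (E : LinearMap.range β →ₗ[F] LinearMap.range β),
      (∀ s, E s ∈ N) → (∀ (c : C) s, E (W.toRepresentation c s) = W.toRepresentation c (E s)) →
      Function.Bijective (relTrace (Q ⊔ C) M.ρ M.ρ (βE E)) → N = ⊤ := by
    intro N E hEN hE hEbij
    have hmem : βE E ∈ X := by
      refine ⟨hβE E hE, fun q hq m => ?_, hEbij⟩
      change M.ρ q (E (β.rangeRestrict m) : LinearMap.range β) =
        (E (β.rangeRestrict m) : LinearMap.range β)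
      obtain ⟨m', hm'⟩ := (E (β.rangeRestrict m)).2
      rw [← hm', hβQ q hq]
    have h1 : LinearMap.range (βE E) ≤ N.map (LinearMap.range β).subtype := by
      rintro _ ⟨m, rfl⟩
      exact ⟨_, hEN _, rfl⟩
    have h2 := (Submodule.finrank_mono h1).trans (Submodule.finrank_map_le _ N)
    exact Submodule.eq_top_of_finrank_eq
      (le_antisymm (Submodule.finrank_le N) ((not_lt.mp (hmin _ hmem)).trans h2))
  have hcard : NeZero (Nat.card C : F) :=
    ⟨fun h0 => h.not_dvd_card ((CharP.cast_eq_zero_iff F p _).mp h0)⟩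
  have hirr : W.toRepresentation.IsIrreducible := by
    have hnontriv : Nontrivial (Subrepresentation W.toRepresentation) := by
      refine ⟨⊥, ⊤, fun hbt => ?_⟩
      have hβ0 : β = 0 := by
        ext m
        have h1 : β.rangeRestrict m ∈ (⊤ : Subrepresentation W.toRepresentation).toSubmodule :=
          Submodule.mem_top
        rw [← hbt] at h1
        exact congrArg Subtype.val ((Submodule.mem_bot F).mp h1)
      obtain ⟨m, hm⟩ := exists_ne (0 : M.V)
      refine hm (hβbij.1 ?_)
      rw [hβ0, relTrace_apply, relTrace_apply]
      simp
    refine ⟨fun N => ?_⟩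
    obtain ⟨N', hNN'⟩ := exists_isCompl N
    have hc : IsCompl N.toSubmodule N'.toSubmodule := by
      refine IsCompl.of_eq ?_ ?_
      · exact congrArg Subrepresentation.toSubmodule hNN'.inf_eq_bot
      · exact congrArg Subrepresentation.toSubmodule hNN'.sup_eq_top
    have hE := fun c => projection_equivariant hc (f := W.toRepresentation c)
      (fun _ hs => N.apply_mem_toSubmodule c hs) (fun _ hs => N'.apply_mem_toSubmodule c hs)
    have hE' := fun c => projection_equivariant hc.symm (f := W.toRepresentation c)
      (fun _ hs => N'.apply_mem_toSubmodule c hs) (fun _ hs => N.apply_mem_toSubmodule c hs)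
    have hsum : βE (N.toSubmodule.projection _ hc) + βE (N'.toSubmodule.projection _ hc.symm) =
        β := by
      simp only [βE]
      rw [← LinearMap.comp_add, ← LinearMap.add_comp, Submodule.projection_add_projection_eq_id]
      rfl
    rw [← hsum, relTrace_add] at hβbij
    rcases bijective_or_bijective_of_add hind (relTrace_equivariant (hβE _ hE))
      (relTrace_equivariant (hβE _ hE')) hβbij with hb | hb
    · right
      exact Subrepresentation.toSubmodule_injective (key N.toSubmodule _
        (fun s => Submodule.projection_apply_mem hc s) hE hb)
    · left
      have h1 := key N'.toSubmodule _ (fun s => Submodule.projection_apply_mem hc.symm s) hE' hb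
      have h2 := hc.inf_eq_bot
      rw [h1, inf_top_eq] at h2
      exact Subrepresentation.toSubmodule_injective h2
  obtain ⟨θ, hθ, hβθ⟩ := exists_equivariant_inverse (relTrace_equivariant hβ) hβbij
  obtain ⟨hret⟩ := nonempty_retract_ind.{u, v, w} (M := M)
    (N := Rep.res (proj Q C h.le_normalizer h.disjoint) (Rep.of W.toRepresentation))
    (a := β.rangeRestrict ∘ₗ θ) (b := (LinearMap.range β).subtype)
    (fun g m => by
      rw [LinearMap.comp_apply, hθ, hβW]
      rfl)
    (fun g s => (hW g s).symm) (by
      rw [← hβθ, relTrace_comp _ hθ]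
      rfl)
  obtain ⟨ι, π, I⟩ := exists_isInflInduced.{u, v, w} h (Rep.of W.toRepresentation)
  obtain ⟨i⟩ := nonempty_iso_of_retract (I.indecomposable hirr) hnt hret
  exact ⟨Rep.of W.toRepresentation, hirr, ⟨i.symm⟩⟩

end Surjectivity

end PPerm

theorem PPerm.isIndecPPermWithVertex_inflInd {p : ℕ} [Fact p.Prime] {F : Type u} [Field F]
    [CharP F p] {G : Type v} [Group G] [Finite G] {P Q C : Subgroup G}
    (h : PPerm.LocalConfig p P Q C) {S : Rep.{max u v w} F C} (hS : S.ρ.IsIrreducible) :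
    PPerm.IsIndecPPermWithVertex.{u, v, w} p Q
      ((PPerm.inflInd.{u, v, w} F Q C h.le_normalizer h.disjoint).obj S) := by
  obtain ⟨ι, π, I⟩ := PPerm.exists_isInflInduced.{u, v, w} h S
  have := PPerm.finite_of_isIrreducible hS
  exact ⟨I.indecomposable hS, I.isPPermutation,
    I.isVertex (PPerm.nontrivial_of_isIrreducible hS)⟩

theorem mainTheorem6 (p : ℕ) [Fact p.Prime] (F : Type u) [Field F] [CharP F p]
    (G : Type v) [Group G] [Finite G]
    (P : Sylow p G) (hP : (P : Subgroup G).Normal)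
    (Q : Subgroup G) (hQ : Q ≤ (P : Subgroup G))
    (C : Subgroup G) (hC : C ≤ Subgroup.normalizer (Q : Set G))
    (hcompl : ((P : Subgroup G).subgroupOf (Subgroup.normalizer (Q : Set G))).IsComplement'
      (C.subgroupOf (Subgroup.normalizer (Q : Set G)))) :
    (∀ S : Rep.{max u v w} F C, S.ρ.IsIrreducible →
      PPerm.IsIndecPPermWithVertex.{u, v, w} p Q
        ((PPerm.inflInd.{u, v, w} F Q C hC (PPerm.disjoint_of_compl hQ hC hcompl)).obj S)) ∧
    Set.BijOn
      (PPerm.inflIndClass.{u, v, w} F Q C hC (PPerm.disjoint_of_compl hQ hC hcompl))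
      (PPerm.isoClasses fun S : Rep.{max u v w} F C => S.ρ.IsIrreducible)
      (PPerm.isoClasses fun M : Rep.{max u v w} F G =>
        PPerm.IsIndecPPermWithVertex.{u, v, w} p Q M) := by
  have h := PPerm.localConfig hP hQ hC hcompl
  refine ⟨fun S hS => PPerm.isIndecPPermWithVertex_inflInd h hS, ?_, ?_, ?_⟩
  · rintro _ ⟨S, hS, rfl⟩
    exact ⟨_, PPerm.isIndecPPermWithVertex_inflInd h hS, rfl⟩
  · rintro _ ⟨S, _, rfl⟩ _ ⟨S', _, rfl⟩ hSS'
    obtain ⟨i⟩ := Quotient.exact hSS'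
    exact Quotient.sound (PPerm.nonempty_iso_of_inflInd_iso h i)
  · rintro _ ⟨M, hM, rfl⟩
    obtain ⟨S, hS, hi⟩ := PPerm.IsIndecPPermWithVertex.exists_iso h hM
    exact ⟨_, ⟨S, hS, rfl⟩, Quotient.sound hi⟩
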